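/- Let $q\in\mathbb{C}$ with $0<|q|<1$ and let $a_0,a_1,a_2\in\mathbb{C}^*$ satisfy $a_0a_1a_2=q$ and the non-resonance condition $\pm a_0,\pm a_1,\pm a_2\notin q^{\mathbb{Z}}$. Write $\theta_q(z)=\prod_{n\ge 0}(1-zq^n)(1-q^{n+1}/z)$ and $\theta_q(z_1,\dots,z_m)=\prod_j\theta_q(z_j)$. Let $f=(f_0,f_1,f_2):T\to(\mathbb{CP}^1)^3$, where $T\subseteq\mathbb{C}^*$ is invariant under $t\mapsto qt$ and $t\mapsto q^{-1}t$, be a solution of $q\mathrm{P}_{\mathrm{IV}}(a)$, that is, $f_0f_1f_2=t^2$ and, with $\overline{f}_k=f_k(qt)$ and indices modulo $3$, $$\frac{\overline{f}_k}{a_ka_{k+1}f_{k+1}}=\frac{1+a_{k+2}f_{k+2}(1+a_kf_k)}{1+a_kf_k(1+a_{k+1}f_{k+1})}\qquad(k=0,1,2),$$ these equations being cleared of denominators and written in homogeneous coordinates on $\mathbb{CP}^1$. Monodromy coordinates. At a point $t$ with $f(t)\in(\mathbb{C}^*)^3$ and $t^2\notin q^{\mathbb{Z}}$, choose $u,d\in\mathbb{C}^*$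 and put $L(c,x)=\begin{pmatrix}-ic\frac{t}{x}z&1\\-1&-ic\frac{x}{t}z\end{pmatrix}$ and $$A(z,t)=\begin{pmatrix}u&0\\0&1\end{pmatrix}L(q,f_2)\,L(a_0a_2,f_0)\,L(a_0,f_1)\begin{pmatrix}u^{-1}&0\\0&1\end{pmatrix}.$$ Let $\Phi_\infty(z,t)$ and $\Phi_0(z,t)$ be the $2\times2$ matrix functions, meromorphic in $z\in\mathbb{C}^*$, with $$\Phi_\infty(qz,t)=\tfrac{1}{iqa_0^2a_2}z^{-3}A(z,t)\Phi_\infty(z,t)\begin{pmatrix}t^{-1}&0\\0&t\end{pmatrix},\quad \Phi_\infty=I+\mathcal{O}(z^{-1})\ (z\to\infty),$$ $$\Phi_0(qz,t)=A(z,t)\Phi_0(z,t)\begin{pmatrix}-i&0\\0&i\end{pmatrix},\quad \Phi_0=d\begin{pmatrix}u&0\\0&1\end{pmatrix}\begin{pmatrix}i&-i\\1&1\end{pmatrix}+\mathcal{O}(z)\ (z\to0),$$ and let $C(z,t)=\Phi_0(z,t)^{-1}\Phi_\infty(z,t)$. At the remaining points of a $q$-spiral that contains such a point, $C$ is defined through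 $C(z,qt)=\sigma_3C(z,t)z^{-\sigma_3}$, where $\sigma_3=\operatorname{diag}(1,-1)$. The monodromy coordinates are $\rho(t)=(\rho_1,\rho_2,\rho_3)\in(\mathbb{CP}^1)^3$, where $\rho_k(t)$ is the ratio of the first row to the second row of the rank one matrix $C(x_k,t)$, with $(x_1,x_2,x_3)=(a_0^{-1},a_1/q,q^{-1})$; they do not depend on the choice of $u,d$. Let $$\beta_0=\theta_q(a_0,a_1,a_2),\quad \beta_1=\theta_q(-a_0,a_1,-a_2),\quad \beta_2=\theta_q(a_0,-a_1,-a_2),\quad \beta_3=\theta_q(-a_0,-a_1,a_2).$$ Statement. Let $t_0\in T$ with $t_0^2\notin q^{\mathbb{Z}}$, and suppose that $f(t)\in(\mathbb{C}^*)^3$ for at least one $t\in q^{\mathbb{Z}}t_0$. Then $p=\rho(t_0)$ does not lie on the curve in $(\mathbb{CP}^1)^3$ defined by $$0=\beta_0p_1p_2p_3-\beta_1p_1+\beta_2p_2-\beta_3p_3,\qquad 0=\beta_0-\beta_1p_2p_3+\beta_2p_1p_3-\beta_3p_1p_2$$ (in homogeneous coordinates). Moreover, every point $p$ of this curve satisfies,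 for every $t\in\mathbb{C}^*$, the monodromy cubic $$0=\beta_0[\theta_q(t)p_1p_2p_3-\theta_q(-t)]-\beta_1[\theta_q(t)p_1-\theta_q(-t)p_2p_3]+\beta_2[\theta_q(t)p_2-\theta_q(-t)p_1p_3]-\beta_3[\theta_q(t)p_3-\theta_q(-t)p_1p_2].$$ -/

import Mathlib

open scoped Topology Matrix

noncomputable section

namespace QPIV

/-- The complex projective line, with homogeneous coordinates `[v 0 : v 1]`. -/
abbrev CP1 : Type := Projectivization ℂ (Fin 2 → ℂ)

/-- First homogeneous coordinate (of a chosen representative). -/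
def num (p : CP1) : ℂ := p.rep 0

/-- Second homogeneous coordinate (of the same representative); the affine value is `num / den`. -/
def den (p : CP1) : ℂ := p.rep 1

/-- The affine value of a point of the projective line (meaningful away from the point at
infinity). -/
def affine (p : CP1) : ℂ := num p / den p

/-- The point is neither `0` nor `∞`, i.e. it lies in `ℂ^*`. -/
def InCStar (p : CP1) : Prop := num p ≠ 0 ∧ den p ≠ 0

/-- `(f₀, f₁, f₂) ∈ (ℂ^*)³`. -/
def IsNonsingular (f : Fin 3 → CP1) : Prop := ∀ k, InCStar (f k)

/-- The infinite product `(z; q)_∞`. -/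
def qPoch (z q : ℂ) : ℂ := ∏' n : ℕ, (1 - z * q ^ n)

/-- The theta function `θ_q(z) = (z; q)_∞ (q / z; q)_∞`. -/
def theta (q z : ℂ) : ℂ := qPoch z q * qPoch (q / z) q

/-- Parameters of `qP_IV`: `0 < |q| < 1`, non-zero `a₀, a₁, a₂` with `a₀ a₁ a₂ = q`. -/
structure IsParameter (q : ℂ) (a : Fin 3 → ℂ) : Prop where
  q_ne_zero : q ≠ 0
  norm_q_lt_one : ‖q‖ < 1
  a_ne_zero : ∀ k, a k ≠ 0
  prod_a : a 0 * a 1 * a 2 = q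

/-- Non-resonance: `±a₀, ±a₁, ±a₂ ∉ q^ℤ`. It says that the six points `±1/a₀, ±a₁/q, ±1/q`, at
which the determinant of the connection matrix vanishes, are pairwise distinct modulo `q^ℤ`. -/
def NonResonant (q : ℂ) (a : Fin 3 → ℂ) : Prop :=
  ∀ k : Fin 3, ∀ n : ℤ, a k ≠ q ^ n ∧ a k ≠ -q ^ n

/-- `f` is a solution of `qP_IV(a)` on the `q`-invariant domain `T ⊆ ℂ^*`, with values in `(ℂP¹)³`:
`f₀ f₁ f₂ = t²` and, cyclically in `k`, with `f̄ = f(q t)`,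
`f̄_k / (a_k a_{k+1} f_{k+1}) =
  (1 + a_{k+2} f_{k+2} (1 + a_k f_k)) / (1 + a_k f_k (1 + a_{k+1} f_{k+1}))`.
The equations are cleared of denominators, in homogeneous coordinates, so that they make sense
at all values in `(ℂP¹)³`; being closed conditions, they also hold for solutions that are continued
through singular values. -/
structure IsSolution (q : ℂ) (a : Fin 3 → ℂ) (T : Set ℂ) (f : ℂ → Fin 3 → CP1) : Prop where
  zero_notMem : (0 : ℂ) ∉ T
  mul_mem_iff : ∀ t, q * t ∈ T ↔ t ∈ T
  product : ∀ t ∈ T, ∏ k, num (f t k) = t ^ 2 * ∏ k, den (f t k)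
  evolution : ∀ t ∈ T, ∀ k : Fin 3,
    num (f (q * t) k) *
        (den (f t k) * den (f t (k + 1)) +
          a k * num (f t k) * (den (f t (k + 1)) + a (k + 1) * num (f t (k + 1)))) *
        den (f t (k + 2)) =
      a k * a (k + 1) * num (f t (k + 1)) *
        (den (f t (k + 2)) * den (f t k) +
          a (k + 2) * num (f t (k + 2)) * (den (f t k) + a k * num (f t k))) *
        den (f (q * t) k)

/-- The factor `((-i c (t/x) z, 1), (-1, -i c (x/t) z))`. -/
def laxFactor (t c x z : ℂ) : Matrix (Fin 2) (Fin 2) ℂ :=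
  !![-Complex.I * c * (t / x) * z, 1; -1, -Complex.I * c * (x / t) * z]

/-- The matrix `A(z, t)` of the spectral equation `Y(qz) = A(z, t) Y(z)`, where `x = f(t)` is a
value in `(ℂ^*)³` and `u = u(t) ≠ 0` is the value of the auxiliary variable. -/
def laxA (q : ℂ) (a : Fin 3 → ℂ) (t : ℂ) (x : Fin 3 → ℂ) (u z : ℂ) : Matrix (Fin 2) (Fin 2) ℂ :=
  !![u, 0; 0, 1] * laxFactor t q (x 2) z * laxFactor t (a 0 * a 2) (x 0) z *
    laxFactor t (a 0) (x 1) z * !![u⁻¹, 0; 0, 1]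

/-- `M₀ = d · diag(u, 1) · ((i, -i), (1, 1))`. -/
def matM0 (u d : ℂ) : Matrix (Fin 2) (Fin 2) ℂ :=
  d • (!![u, 0; 0, 1] * !![Complex.I, -Complex.I; 1, 1])

/-- `Φ` is the canonical solution at `z = ∞`: it is meromorphic on `ℂ^*`, satisfies
`Φ(qz) = (q a₀² a₂ i)⁻¹ z⁻³ A(z) Φ(z) diag(t⁻¹, t)` as an identity of meromorphic functions (so off
the poles), and `Φ(z) = I + O(1/z)` as `z → ∞`. -/
structure IsCanonicalAtInfinity (q : ℂ) (a : Fin 3 → ℂ) (t : ℂ)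
    (A Φ : ℂ → Matrix (Fin 2) (Fin 2) ℂ) : Prop where
  meromorphic : ∀ i j, MeromorphicOn (fun z => Φ z i j) {0}ᶜ
  equation : ∀ z₀ : ℂ, z₀ ≠ 0 → ∀ᶠ z in 𝓝[≠] z₀,
    Φ (q * z) = ((q * a 0 ^ 2 * a 2 * Complex.I)⁻¹ * (z ^ 3)⁻¹) •
      (A z * Φ z * !![t⁻¹, 0; 0, t])
  asymptotic : ∀ i j, Asymptotics.IsBigO (Bornology.cobounded ℂ)
    (fun z => Φ z i j - (1 : Matrix (Fin 2) (Fin 2) ℂ) i j) (fun z => z⁻¹)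

/-- `Φ` is the canonical solution at `z = 0`: it is meromorphic on `ℂ^*`, satisfies
`Φ(qz) = A(z) Φ(z) diag(-i, i)` as an identity of meromorphic functions (so off the poles), and
`Φ(z) = M₀ + O(z)` as `z → 0`. -/
structure IsCanonicalAtZero (q : ℂ) (A : ℂ → Matrix (Fin 2) (Fin 2) ℂ)
    (M₀ : Matrix (Fin 2) (Fin 2) ℂ) (Φ : ℂ → Matrix (Fin 2) (Fin 2) ℂ) : Prop where
  meromorphic : ∀ i j, MeromorphicOn (fun z => Φ z i j) {0}ᶜ
  equation : ∀ z₀ : ℂ, z₀ ≠ 0 → ∀ᶠ z in 𝓝[≠] z₀,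
    Φ (q * z) = A z * Φ z * !![-Complex.I, 0; 0, Complex.I]
  asymptotic : ∀ i j, Asymptotics.IsBigO (𝓝[≠] (0 : ℂ))
    (fun z => Φ z i j - M₀ i j) (fun z => z)

/-- The connection matrix `C(z) = Φ₀(z)⁻¹ Φ_∞(z)`. The entries are meromorphic functions on `ℂ^*`,
and they are taken in normal form: at removable singularities, such as those at poles of the
canonical solutions, the value is the limit. -/
def connectionMatrix (Φ₀ Φinf : ℂ → Matrix (Fin 2) (Fin 2) ℂ) (z : ℂ) :
    Matrix (Fin 2) (Fin 2) ℂ :=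
  Matrix.of fun i j => toMeromorphicNFOn (fun w => ((Φ₀ w)⁻¹ * Φinf w) i j) {0}ᶜ z

/-- `p = π(R)`: `R` has rank one and its rows satisfy `r₁ = p r₂`, written homogeneously. -/
def IsRowRatio (R : Matrix (Fin 2) (Fin 2) ℂ) (p : CP1) : Prop :=
  R.rank = 1 ∧ ∀ j, den p * R 0 j = num p * R 1 j

/-- `C` is a connection matrix `C(·, t₀)` of the solution `f`. If `f(t₀) ∈ (ℂ^*)³`, the case `n = 0`
says that `C = Φ₀⁻¹ Φ_∞` for the spectral equation at `t₀`. In general the connection matrix is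
obtained at a point `q ^ n * t₀` with `f(q ^ n * t₀) ∈ (ℂ^*)³` and carried to `t₀` by the time
evolution `C(z, q t) = σ₃ C(z, t) z^{-σ₃}`. The non-zero numbers `u`, `d` are the values at
`q ^ n * t₀` of the auxiliary variable and of the normalisation of `Φ₀`. -/
def IsConnectionMatrix (q : ℂ) (a : Fin 3 → ℂ) (f : ℂ → Fin 3 → CP1) (t₀ : ℂ)
    (C : ℂ → Matrix (Fin 2) (Fin 2) ℂ) : Prop :=
  ∃ (n : ℤ) (u d : ℂ) (Φ₀ Φinf : ℂ → Matrix (Fin 2) (Fin 2) ℂ),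
    IsNonsingular (f (q ^ n * t₀)) ∧ u ≠ 0 ∧ d ≠ 0 ∧
    IsCanonicalAtZero q (laxA q a (q ^ n * t₀) (fun k => affine (f (q ^ n * t₀) k)) u)
      (matM0 u d) Φ₀ ∧
    IsCanonicalAtInfinity q a (q ^ n * t₀)
      (laxA q a (q ^ n * t₀) (fun k => affine (f (q ^ n * t₀) k)) u) Φinf ∧
    ∀ z, C z = !![1, 0; 0, (-1) ^ n] * connectionMatrix Φ₀ Φinf z * !![z ^ n, 0; 0, z ^ (-n)]

/-- The points `(x₁, x₂, x₃) = (1/a₀, a₁/q, 1/q)`. -/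
def evalPoint (q : ℂ) (a : Fin 3 → ℂ) : Fin 3 → ℂ := ![(a 0)⁻¹, a 1 / q, q⁻¹]

/-- `p = ρ(t₀)`: the monodromy coordinates `ρ_k(t₀) = π(C(x_k, t₀))`, `k = 1, 2, 3`. -/
def IsMonodromyCoordinates (q : ℂ) (a : Fin 3 → ℂ) (f : ℂ → Fin 3 → CP1) (t₀ : ℂ)
    (p : Fin 3 → CP1) : Prop :=
  ∃ C, IsConnectionMatrix q a f t₀ C ∧ ∀ k, IsRowRatio (C (evalPoint q a k)) (p k)

/-- `β₀ = θ_q(a₀) θ_q(a₁) θ_q(a₂)`, `β₁ = θ_q(-a₀) θ_q(a₁) θ_q(-a₂)`,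
`β₂ = θ_q(a₀) θ_q(-a₁) θ_q(-a₂)`, `β₃ = θ_q(-a₀) θ_q(-a₁) θ_q(a₂)`. -/
def beta (q : ℂ) (a : Fin 3 → ℂ) : Fin 4 → ℂ :=
  ![theta q (a 0) * theta q (a 1) * theta q (a 2),
    theta q (-a 0) * theta q (a 1) * theta q (-a 2),
    theta q (a 0) * theta q (-a 1) * theta q (-a 2),
    theta q (-a 0) * theta q (-a 1) * theta q (a 2)]

/-- The monodromy cubic
`0 = β₀ [θ(t) p₁ p₂ p₃ - θ(-t)] - β₁ [θ(t) p₁ - θ(-t) p₂ p₃] + β₂ [θ(t) p₂ - θ(-t) p₁ p₃]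
  - β₃ [θ(t) p₃ - θ(-t) p₁ p₂]`
on `(ℂP¹)³`, in homogeneous coordinates. -/
def OnMonodromyCubic (q : ℂ) (a : Fin 3 → ℂ) (t : ℂ) (p : Fin 3 → CP1) : Prop :=
  beta q a 0 * (theta q t * (num (p 0) * num (p 1) * num (p 2))
      - theta q (-t) * (den (p 0) * den (p 1) * den (p 2)))
    - beta q a 1 * (theta q t * (num (p 0) * den (p 1) * den (p 2))
      - theta q (-t) * (den (p 0) * num (p 1) * num (p 2)))
    + beta q a 2 * (theta q t * (den (p 0) * num (p 1) * den (p 2))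
      - theta q (-t) * (num (p 0) * den (p 1) * num (p 2)))
    - beta q a 3 * (theta q t * (den (p 0) * den (p 1) * num (p 2))
      - theta q (-t) * (num (p 0) * num (p 1) * den (p 2))) = 0

/-- The curve in `(ℂP¹)³` cut out by the two cubics
`0 = β₀ p₁ p₂ p₃ - β₁ p₁ + β₂ p₂ - β₃ p₃` and `0 = β₀ - β₁ p₂ p₃ + β₂ p₁ p₃ - β₃ p₁ p₂`,
in homogeneous coordinates. -/
def OnForbiddenCurve (q : ℂ) (a : Fin 3 → ℂ) (p : Fin 3 → CP1) : Prop :=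
  beta q a 0 * (num (p 0) * num (p 1) * num (p 2))
      - beta q a 1 * (num (p 0) * den (p 1) * den (p 2))
      + beta q a 2 * (den (p 0) * num (p 1) * den (p 2))
      - beta q a 3 * (den (p 0) * den (p 1) * num (p 2)) = 0 ∧
    beta q a 0 * (den (p 0) * den (p 1) * den (p 2))
      - beta q a 1 * (den (p 0) * num (p 1) * num (p 2))
      + beta q a 2 * (num (p 0) * den (p 1) * num (p 2))
      - beta q a 3 * (num (p 0) * num (p 1) * den (p 2)) = 0

end QPIV

end

/-!
The connection matrix `C(z) = Φ₀(z)⁻¹ Φ_∞(z)` is holomorphic on the punctured plane, because `Φ_∞`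
continues from `∞` inwards and `Φ₀⁻¹` from `0` outwards without poles. With `κ = x₁ x₂ x₃` it
satisfies `C(q z) = κ z⁻³ σ₃ C(z) t^{-σ₃}`, and uniqueness of the canonical solutions
(`eventually_eq_of_asymptotic`) gives the reflection symmetry `C(-z) = -σ₁ C(z) σ₃`. The time
evolution preserves these properties, so they hold at every time of the spiral
(`IsConnectionMatrix.isConnectionLike`). By the symmetry, the monodromy coordinates determine the
row ratio of `C` at all six points `±x_k`.

Suppose that the monodromy coordinates lie on the forbidden curve. The second equation of the curve
is, up to a non-zero factor, the determinant of the three linear conditions which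
`den p_k · g(x_k) = num p_k · g(-x_k)` imposes on the cubic theta functions with
`g(q z) = κ z⁻³ g(z)`. Hence some `g ≠ 0` satisfies them (`exists_theta_of_forbidden`), and
`(g(z), g(-z))` looks like the first column of a connection matrix at time `t = 1`. Its determinant
with a column of `C` is a theta function of degree six that vanishes at the six points `±x_k`; these
zeros prescribe a multiplier which differs from the actual one by `t^{±1} ∉ q^ℤ`, so the determinant
vanishes identically (`eq_zero_of_theta_zeros`, `column_proportional`). Both columns of `C` are thus
proportional to the same vector, which contradicts `det C ≠ 0`.

All vanishing statements reduce to one fact about scalar equations: a solution of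
`h(q z) = μ h(z)` that is `O(z)` at `0` is zero unless `μ` is a positive power of `q`
(`eventually_eq_zero_of_qDifference`).

The monodromy cubic at `t` is `θ(t)` times the first equation of the curve minus `θ(-t)` times the
second, so the curve lies on all of these cubics.
-/

noncomputable section

namespace QPIV

open Filter Asymptotics Set

/-! ### Scalar linear `q`-difference equations on the punctured plane -/

/-- A property that holds near `0` and passes from `q z` to `z` holds on the punctured plane. -/
lemma forall_of_near_zero {q : ℂ} (hq : q ≠ 0) (hq1 : ‖q‖ < 1) {P : ℂ → Prop}
    (h0 : ∃ r > 0, ∀ z ≠ 0, ‖z‖ < r → P z) (hP : ∀ z ≠ 0, P (q * z) → P z) :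
    ∀ z ≠ 0, P z := by
  obtain ⟨r, hr, h0⟩ := h0
  have key : ∀ n : ℕ, ∀ z ≠ 0, P (q ^ n * z) → P z := by
    intro n
    induction n with
    | zero => intro z _ h; simpa using h
    | succ n ih =>
      intro z hz h
      refine ih z hz (hP _ (mul_ne_zero (pow_ne_zero _ hq) hz) ?_)
      rwa [← mul_assoc, ← pow_succ']
  intro z hz
  have hlim : Tendsto (fun n : ℕ => ‖q ^ n * z‖) atTop (𝓝 0) := by
    have := (tendsto_pow_atTop_nhds_zero_of_lt_one (norm_nonneg q) hq1).mul_const ‖z‖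
    simpa using this
  obtain ⟨n, hn⟩ := (hlim.eventually (gt_mem_nhds hr)).exists
  exact key n z hz (h0 _ (mul_ne_zero (pow_ne_zero _ hq) hz) hn)

/-- A property that holds near `∞` and passes from `z` to `q z` holds on the punctured plane. -/
lemma forall_of_near_infinity {q : ℂ} (hq : q ≠ 0) (hq1 : ‖q‖ < 1) {P : ℂ → Prop}
    (h0 : ∃ R : ℝ, ∀ z ≠ 0, R < ‖z‖ → P z) (hP : ∀ z ≠ 0, P z → P (q * z)) :
    ∀ z ≠ 0, P z := by
  obtain ⟨R, h0⟩ := h0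
  have h := forall_of_near_zero (P := fun z => P z⁻¹) hq hq1 ?_ ?_
  · intro z hz
    simpa using h z⁻¹ (inv_ne_zero hz)
  · refine ⟨(|R| + 1)⁻¹, by positivity, fun z hz hzr => h0 _ (inv_ne_zero hz) ?_⟩
    have hz' : 0 < ‖z‖ := norm_pos_iff.2 hz
    rw [norm_inv]
    have : |R| + 1 < ‖z‖⁻¹ := by rwa [lt_inv_comm₀ (by positivity) hz']
    linarith [le_abs_self R]
  · intro z hz h
    have := hP _ (inv_ne_zero (mul_ne_zero hq hz)) h
    rwa [mul_inv, mul_inv_cancel_left₀ hq] at this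

lemma tendsto_const_mul_nhdsNE {c : ℂ} (hc : c ≠ 0) (z₀ : ℂ) :
    Tendsto (fun z => c * z) (𝓝[≠] z₀) (𝓝[≠] (c * z₀)) := by
  refine tendsto_nhdsWithin_iff.2 ⟨?_, ?_⟩
  · exact ((continuous_const_mul c).tendsto z₀).mono_left nhdsWithin_le_nhds
  · filter_upwards [self_mem_nhdsWithin] with z hz
    simpa [hc] using hz

lemma tendsto_neg_nhdsNE (z₀ : ℂ) : Tendsto (fun z : ℂ => -z) (𝓝[≠] z₀) (𝓝[≠] (-z₀)) := by
  simpa using tendsto_const_mul_nhdsNE (c := -1) (by norm_num) z₀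

lemma tendsto_inv_nhdsNE {z₀ : ℂ} (hz₀ : z₀ ≠ 0) :
    Tendsto (fun z : ℂ => z⁻¹) (𝓝[≠] z₀) (𝓝[≠] z₀⁻¹) := by
  refine tendsto_nhdsWithin_iff.2 ⟨?_, ?_⟩
  · exact ((continuousAt_inv₀ hz₀).tendsto).mono_left nhdsWithin_le_nhds
  · filter_upwards [self_mem_nhdsWithin] with z hz
    simpa using hz

lemma eventually_ne_zero_nhdsNE {z₀ : ℂ} (hz₀ : z₀ ≠ 0) : ∀ᶠ z in 𝓝[≠] z₀, z ≠ 0 :=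
  (eventually_ne_nhds hz₀).filter_mono nhdsWithin_le_nhds

/-- `h` is bounded on a punctured neighbourhood of `z₀`. For a meromorphic function this says that
`z₀` is not a pole. -/
def BoundedNear (h : ℂ → ℂ) (z₀ : ℂ) : Prop := h =O[𝓝[≠] z₀] (fun _ => (1 : ℂ))

lemma BoundedNear.of_continuousAt {h : ℂ → ℂ} {z₀ : ℂ} (hh : ContinuousAt h z₀) :
    BoundedNear h z₀ :=
  (hh.isBigO_one ℂ).mono nhdsWithin_le_nhds

lemma BoundedNear.mul {h k : ℂ → ℂ} {z₀ : ℂ} (hh : BoundedNear h z₀) (hk : BoundedNear k z₀) :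
    BoundedNear (fun z => h z * k z) z₀ := by
  simpa [BoundedNear] using IsBigO.mul hh hk

lemma BoundedNear.add {h k : ℂ → ℂ} {z₀ : ℂ} (hh : BoundedNear h z₀) (hk : BoundedNear k z₀) :
    BoundedNear (fun z => h z + k z) z₀ :=
  IsBigO.add hh hk

lemma BoundedNear.congr {h k : ℂ → ℂ} {z₀ : ℂ} (hh : BoundedNear h z₀)
    (hhk : ∀ᶠ z in 𝓝[≠] z₀, h z = k z) : BoundedNear k z₀ :=
  IsBigO.congr' hh hhk EventuallyEq.rfl

lemma BoundedNear.comp_const_mul {h : ℂ → ℂ} {c z₀ : ℂ} (hc : c ≠ 0)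
    (hh : BoundedNear h (c * z₀)) : BoundedNear (fun z => h (c * z)) z₀ :=
  IsBigO.comp_tendsto hh (tendsto_const_mul_nhdsNE hc z₀)

lemma eventually_nhdsNE_mul {c z₀ : ℂ} (hc : c ≠ 0) {P : ℂ → Prop}
    (h : ∀ᶠ z in 𝓝[≠] z₀, P (c * z)) : ∀ᶠ z in 𝓝[≠] (c * z₀), P z := by
  have ht := tendsto_const_mul_nhdsNE (inv_ne_zero hc) (c * z₀)
  rw [inv_mul_cancel_left₀ hc] at ht
  filter_upwards [ht.eventually h] with z hz
  rwa [mul_inv_cancel_left₀ hc] at hz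

lemma BoundedNear.of_comp_const_mul {h : ℂ → ℂ} {c z₀ : ℂ} (hc : c ≠ 0)
    (hh : BoundedNear (fun z => h (c * z)) z₀) : BoundedNear h (c * z₀) := by
  obtain ⟨C, hC⟩ := hh.bound
  exact IsBigO.of_bound C (eventually_nhdsNE_mul hc (P := fun z => ‖h z‖ ≤ C * ‖(1 : ℂ)‖) hC)

lemma exists_forall_eventually_of_eventually_zero {P : ℂ → Prop}
    (hP : ∀ᶠ z in 𝓝[≠] (0 : ℂ), P z) : ∃ r > 0, ∀ z ≠ 0, ‖z‖ < r → ∀ᶠ w in 𝓝[≠] z, P w := by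
  rw [eventually_nhdsWithin_iff, Metric.eventually_nhds_iff] at hP
  obtain ⟨r, hr, hP⟩ := hP
  refine ⟨r, hr, fun z hz hzr => ?_⟩
  have h1 : ∀ᶠ w in 𝓝 z, ‖w‖ < r := (continuous_norm.tendsto z).eventually (gt_mem_nhds hzr)
  filter_upwards [h1.filter_mono nhdsWithin_le_nhds, eventually_ne_zero_nhdsNE hz] with w hw hw0
  exact hP (by simpa using hw) hw0

lemma exists_forall_eventually_of_eventually_cobounded {P : ℂ → Prop}
    (hP : ∀ᶠ z in Bornology.cobounded ℂ, P z) :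
    ∃ R : ℝ, ∀ z ≠ 0, R < ‖z‖ → ∀ᶠ w in 𝓝[≠] z, P w := by
  obtain ⟨R, -, hP⟩ := (hasBasis_cobounded_norm.eventually_iff).1 hP
  refine ⟨R, fun z _ hzr => ?_⟩
  have h1 : ∀ᶠ w in 𝓝 z, R < ‖w‖ := (continuous_norm.tendsto z).eventually (lt_mem_nhds hzr)
  filter_upwards [h1.filter_mono nhdsWithin_le_nhds] with w hw
  exact hP hw.le

lemma analyticAt_toMeromorphicNFOn_of_boundedNear {h : ℂ → ℂ} {U : Set ℂ} (hm : MeromorphicOn h U)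
    {z : ℂ} (hz : z ∈ U) (hb : BoundedNear h z) : AnalyticAt ℂ (toMeromorphicNFOn h U) z := by
  have hnf := meromorphicNFOn_toMeromorphicNFOn h U hz
  rw [← hnf.meromorphicOrderAt_nonneg_iff_analyticAt, meromorphicOrderAt_toMeromorphicNFOn hm hz]
  by_contra! hneg
  have h1 := tendsto_cobounded_of_meromorphicOrderAt_neg hneg
  obtain ⟨C, hC⟩ := hb.bound
  have h2 := (tendsto_norm_cobounded_atTop.comp h1).eventually_gt_atTop C
  obtain ⟨w, hw, hw'⟩ := (hC.and h2).exists
  simp only [norm_one, mul_one, Function.comp] at hw hw'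
  linarith

/-- Riemann's theorem for a meromorphic function without poles on the punctured plane. -/
lemma exists_analyticAt_of_boundedNear {h : ℂ → ℂ} (hm : MeromorphicOn h {0}ᶜ)
    (hb : ∀ z ≠ 0, BoundedNear h z) :
    ∃ k : ℂ → ℂ, (∀ z ≠ 0, AnalyticAt ℂ k z) ∧ ∀ z ≠ 0, ∀ᶠ w in 𝓝[≠] z, h w = k w :=
  ⟨toMeromorphicNFOn h {0}ᶜ,
    fun z hz => analyticAt_toMeromorphicNFOn_of_boundedNear hm (by simpa using hz) (hb z hz),
    fun z hz => (hm.toMeromorphicNFOn_eq_self_on_nhdsNE (by simpa using hz)).symm⟩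

lemma eq_of_eventually_eq_nhdsNE {E : Type*} [TopologicalSpace E] [T2Space E] {h k : ℂ → E} {z : ℂ}
    (hh : ContinuousAt h z) (hk : ContinuousAt k z) (e : ∀ᶠ w in 𝓝[≠] z, h w = k w) : h z = k z :=
  ((hh.eventuallyEq_nhds_iff_eventuallyEq_nhdsNE hk).1 e).eq_of_nhds

/-- The holomorphic representative of a solution of `h(q z) = μ h(z)` satisfies the equation
everywhere on the punctured plane. -/
lemma qDifference_of_eventually_eq {q μ : ℂ} (hq : q ≠ 0) {h k : ℂ → ℂ}
    (hk : ∀ z ≠ 0, AnalyticAt ℂ k z) (hhk : ∀ z ≠ 0, ∀ᶠ w in 𝓝[≠] z, h w = k w)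
    (he : ∀ z₀ ≠ 0, ∀ᶠ z in 𝓝[≠] z₀, h (q * z) = μ * h z) : ∀ z ≠ 0, k (q * z) = μ * k z := by
  intro z hz
  refine eq_of_eventually_eq_nhdsNE (h := fun z => k (q * z)) (k := fun z => μ * k z) ?_ ?_ ?_
  · exact ContinuousAt.comp (f := fun z => q * z) (g := k)
      (hk _ (mul_ne_zero hq hz)).continuousAt (by fun_prop)
  · exact continuousAt_const.mul (hk z hz).continuousAt
  · filter_upwards [he z hz, hhk z hz,
      (tendsto_const_mul_nhdsNE hq z).eventually (hhk _ (mul_ne_zero hq hz))] with w e1 e2 e3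
    rw [← e2, ← e3, e1]

/-- The leading exponent at `0` of a holomorphic solution of `k(q z) = μ k(z)` is an `n` with
`μ = q ^ n`, so there is no solution without constant term unless `μ` is a positive power of `q`. -/
lemma eventually_eq_zero_of_qDifference_analytic {q μ : ℂ} {k : ℂ → ℂ}
    (hk : AnalyticAt ℂ k 0) (hk0 : k 0 = 0) (hμ : ∀ n : ℕ, n ≠ 0 → μ ≠ q ^ n)
    (he : ∀ᶠ z in 𝓝[≠] (0 : ℂ), k (q * z) = μ * k z) : ∀ᶠ z in 𝓝 (0 : ℂ), k z = 0 := by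
  by_contra hne
  obtain ⟨n, g, hg, hg0, hkg⟩ := hk.exists_eventuallyEq_pow_smul_nonzero_iff.2 hne
  simp only [sub_zero, smul_eq_mul] at hkg
  have hn : n ≠ 0 := by
    rintro rfl
    exact hg0 (by simpa [hk0] using hkg.self_of_nhds.symm)
  have hq0 : Tendsto (fun z => q * z) (𝓝 0) (𝓝 0) := by
    simpa using (continuous_const_mul q).tendsto 0
  have h1 : q ^ n * g (q * 0) = μ * g 0 := by
    refine eq_of_eventually_eq_nhdsNE (h := fun z => q ^ n * g (q * z)) (k := fun z => μ * g z)
      ?_ ?_ ?_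
    · refine continuousAt_const.mul (ContinuousAt.comp (f := fun z => q * z) (g := g) ?_ ?_)
      · simpa using hg.continuousAt
      · fun_prop
    · exact continuousAt_const.mul hg.continuousAt
    · filter_upwards [he, self_mem_nhdsWithin, hkg.filter_mono nhdsWithin_le_nhds,
        (hq0.eventually hkg).filter_mono nhdsWithin_le_nhds] with z hz hz0 e1 e2
      rw [e1, e2] at hz
      have hzn : z ^ n ≠ 0 := pow_ne_zero n hz0
      apply mul_left_cancel₀ hzn
      linear_combination hz
  rw [mul_zero] at h1
  exact hμ n hn (mul_right_cancel₀ hg0 h1).symm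

/-- A meromorphic solution of `h(q z) = μ h(z)` that is `O(z)` at `0` vanishes, unless `μ` is a
positive power of `q`. -/
theorem eventually_eq_zero_of_qDifference {q μ : ℂ} (hq : q ≠ 0) (hq1 : ‖q‖ < 1) (hμ0 : μ ≠ 0)
    (hμ : ∀ n : ℕ, n ≠ 0 → μ ≠ q ^ n) {h : ℂ → ℂ} (hm : MeromorphicOn h {0}ᶜ)
    (hO : h =O[𝓝[≠] (0 : ℂ)] fun z => z)
    (he : ∀ z₀ ≠ 0, ∀ᶠ z in 𝓝[≠] z₀, h (q * z) = μ * h z) :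
    ∀ z₀ ≠ 0, ∀ᶠ z in 𝓝[≠] z₀, h z = 0 := by
  have hO1 : h =O[𝓝[≠] (0 : ℂ)] (fun _ => (1 : ℂ)) :=
    hO.trans ((continuousAt_id.isBigO_one ℂ).mono nhdsWithin_le_nhds)
  have hb : ∀ z ≠ 0, BoundedNear h z := by
    obtain ⟨C, hC⟩ := hO1.bound
    obtain ⟨r, hr, hC⟩ := exists_forall_eventually_of_eventually_zero hC
    refine forall_of_near_zero hq hq1
      ⟨r, hr, fun z hz hzr => IsBigO.of_bound C (hC z hz hzr)⟩ ?_
    intro z hz hb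
    refine ((BoundedNear.of_continuousAt (continuousAt_const (y := μ⁻¹))).mul
      (hb.comp_const_mul hq)).congr ?_
    filter_upwards [he z hz] with w hw
    rw [hw, inv_mul_cancel_left₀ hμ0]
  obtain ⟨k, hk, hhk⟩ := exists_analyticAt_of_boundedNear hm hb
  have hke := qDifference_of_eventually_eq hq hk hhk he
  -- The bound `|h z| ≤ C |z|` passes to the holomorphic representative by continuity.
  obtain ⟨C, hC⟩ := hO.bound
  have hkO : ∀ᶠ z in 𝓝[≠] (0 : ℂ), ‖k z‖ ≤ C * ‖z‖ := by
    obtain ⟨r, hr, hC⟩ := exists_forall_eventually_of_eventually_zero hC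
    rw [eventually_nhdsWithin_iff, Metric.eventually_nhds_iff]
    refine ⟨r, hr, fun z hzr hz => ?_⟩
    have hz : z ≠ 0 := hz
    refine le_of_tendsto_of_tendsto (b := 𝓝[≠] z)
      ((hk z hz).continuousAt.norm.tendsto.mono_left nhdsWithin_le_nhds)
      (((continuous_const.mul continuous_norm).tendsto z).mono_left nhdsWithin_le_nhds) ?_
    filter_upwards [hC z hz (by simpa using hzr), hhk z hz] with w hw e
    rwa [← e]
  have hk0 : Tendsto k (𝓝[≠] 0) (𝓝 0) := by
    refine squeeze_zero_norm' hkO ?_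
    have : Tendsto (fun z : ℂ => C * ‖z‖) (𝓝 0) (𝓝 (C * ‖(0 : ℂ)‖)) :=
      (continuous_const.mul continuous_norm).tendsto 0
    simpa using this.mono_left nhdsWithin_le_nhds
  classical
  set K : ℂ → ℂ := Function.update k 0 0 with hK
  have hKk : ∀ z ≠ 0, K z = k z := fun z hz => by simp [hK, hz]
  have hKan : AnalyticAt ℂ K 0 := by
    refine Complex.analyticAt_of_differentiable_on_punctured_nhds_of_continuousAt ?_ ?_
    · filter_upwards [self_mem_nhdsWithin] with z hz
      have : K =ᶠ[𝓝 z] k := by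
        filter_upwards [eventually_ne_nhds hz] with w hw using hKk w hw
      exact this.differentiableAt_iff.2 (hk z hz).differentiableAt
    · exact continuousAt_update_same.2 hk0
  have hK0 : ∀ᶠ z in 𝓝 (0 : ℂ), K z = 0 := by
    refine eventually_eq_zero_of_qDifference_analytic hKan (by simp [hK]) hμ ?_
    filter_upwards [self_mem_nhdsWithin] with z hz
    rw [hKk z hz, hKk _ (mul_ne_zero hq hz), hke z hz]
  have hzero : ∀ z ≠ 0, k z = 0 := by
    refine forall_of_near_zero hq hq1 ?_ ?_
    · obtain ⟨r, hr, h⟩ := Metric.eventually_nhds_iff.1 hK0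
      exact ⟨r, hr, fun z hz hzr => hKk z hz ▸ h (by simpa using hzr)⟩
    · intro z hz h
      rw [hke z hz] at h
      exact (mul_eq_zero.1 h).resolve_left hμ0
  intro z hz
  filter_upwards [hhk z hz, eventually_ne_zero_nhdsNE hz] with w e hw
  rw [e, hzero w hw]

/-- The analogue of `eventually_eq_zero_of_qDifference` at `∞`. -/
theorem eventually_eq_zero_of_qDifference_infinity {q μ : ℂ} (hq : q ≠ 0) (hq1 : ‖q‖ < 1)
    (hμ0 : μ ≠ 0) (hμ : ∀ n : ℕ, n ≠ 0 → μ⁻¹ ≠ q ^ n) {h : ℂ → ℂ} (hm : MeromorphicOn h {0}ᶜ)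
    (hO : h =O[Bornology.cobounded ℂ] fun z => z⁻¹)
    (he : ∀ z₀ ≠ 0, ∀ᶠ z in 𝓝[≠] z₀, h (q * z) = μ * h z) :
    ∀ z₀ ≠ 0, ∀ᶠ z in 𝓝[≠] z₀, h z = 0 := by
  have key := eventually_eq_zero_of_qDifference (h := fun w => h w⁻¹) hq hq1 (inv_ne_zero hμ0) hμ
    ?_ ?_ ?_
  · intro z hz
    filter_upwards [(tendsto_inv_nhdsNE hz).eventually (key _ (inv_ne_zero hz))] with w hw
    simpa using hw
  · intro z hz
    have hz : z ≠ 0 := hz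
    exact (hm z⁻¹ (by simpa using hz)).comp_analyticAt (analyticAt_inv hz)
  · have := hO.comp_tendsto (tendsto_inv₀_nhdsNE_zero (α := ℂ))
    simpa [Function.comp_def, Function.id_def] using this
  · intro z hz
    have h1 := ((tendsto_inv_nhdsNE (mul_ne_zero hq hz)).comp
      (tendsto_const_mul_nhdsNE hq z)).eventually (he _ (inv_ne_zero (mul_ne_zero hq hz)))
    filter_upwards [h1] with w hw
    simp only [Function.comp, mul_inv] at hw ⊢
    rw [mul_inv_cancel_left₀ hq] at hw
    rw [hw, inv_mul_cancel_left₀ hμ0]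

/-- A holomorphic function on the punctured plane with `h(q z) = μ h(z)` vanishes, unless `μ` is an
integral power of `q`: it grows at most like a power of `z` at `0`, so that the preceding vanishing
result applies to `z ^ m h(z)` for large `m`. -/
theorem eq_zero_of_qDifference_of_analytic {q μ : ℂ} (hq : q ≠ 0) (hq1 : ‖q‖ < 1) (hμ0 : μ ≠ 0)
    (hμ : ∀ n : ℤ, μ ≠ q ^ n) {h : ℂ → ℂ} (ha : ∀ z ≠ 0, AnalyticAt ℂ h z)
    (he : ∀ z ≠ 0, h (q * z) = μ * h z) : ∀ z ≠ 0, h z = 0 := by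
  have hqn : 0 < ‖q‖ := norm_pos_iff.2 hq
  obtain ⟨m, hm⟩ : ∃ m : ℕ, ‖q‖ ^ m * ‖μ‖ ≤ 1 := by
    have := (tendsto_pow_atTop_nhds_zero_of_lt_one (norm_nonneg q) hq1).mul_const ‖μ‖
    rw [zero_mul] at this
    exact ((this.eventually (gt_mem_nhds one_pos)).exists).imp fun _ h => h.le
  have hcomp : IsCompact (Metric.closedBall (0 : ℂ) 1 \ Metric.ball 0 ‖q‖) :=
    (isCompact_closedBall 0 1).diff Metric.isOpen_ball
  obtain ⟨M, hM⟩ := hcomp.exists_bound_of_continuousOn (f := h) (by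
    intro z hz
    refine (ha z ?_).continuousAt.continuousWithinAt
    rintro rfl
    exact hz.2 (by simpa using hq))
  have hpow : ∀ (n : ℕ) (z : ℂ), z ≠ 0 → h (q ^ n * z) = μ ^ n * h z := by
    intro n
    induction n with
    | zero => simp
    | succ n ih =>
      intro z hz
      rw [pow_succ', mul_assoc, he _ (mul_ne_zero (pow_ne_zero _ hq) hz), ih z hz]
      ring
  have hbound : ∀ z ≠ 0, ‖z‖ ≤ 1 → ‖z ^ (m + 1) * h z‖ ≤ M * ‖z‖ := by
    intro z hz hz1
    have hzn : 0 < ‖z‖ := norm_pos_iff.2 hz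
    obtain ⟨n, hn1, hn2⟩ := exists_nat_pow_near_of_lt_one hzn hz1 hqn hq1
    set w := z / q ^ n with hw
    have hw0 : w ≠ 0 := div_ne_zero hz (pow_ne_zero _ hq)
    have hzw : z = q ^ n * w := by rw [hw]; field_simp
    have hw1 : ‖w‖ ≤ 1 := by
      rw [hw, norm_div, norm_pow]
      exact div_le_one_of_le₀ hn2 (by positivity)
    have hw2 : ‖q‖ ≤ ‖w‖ := by
      rw [hw, norm_div, norm_pow, le_div_iff₀ (by positivity), ← pow_succ']
      exact hn1.le
    have hMw : ‖h w‖ ≤ M := hM w ⟨by simpa using hw1, by simpa using hw2⟩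
    have e : z ^ (m + 1) * h z = z * ((q ^ m * μ) ^ n * w ^ m * h w) := by
      conv_lhs => rw [pow_succ', mul_assoc, show h z = μ ^ n * h w by rw [hzw, hpow n w hw0]]
      conv_lhs => rw [show z ^ m = (q ^ n) ^ m * w ^ m by rw [hzw, mul_pow]]
      rw [mul_pow, ← pow_mul, ← pow_mul, mul_comm n m]
      ring
    rw [e, norm_mul, mul_comm]
    gcongr
    rw [norm_mul, norm_mul, norm_pow, norm_mul, norm_pow, norm_pow]
    have h1 : (‖q‖ ^ m * ‖μ‖) ^ n ≤ 1 := pow_le_one₀ (by positivity) hm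
    have h2 : ‖w‖ ^ m ≤ 1 := pow_le_one₀ (by positivity) hw1
    calc (‖q‖ ^ m * ‖μ‖) ^ n * ‖w‖ ^ m * ‖h w‖ ≤ 1 * 1 * ‖h w‖ := by gcongr
      _ ≤ M := by simpa using hMw
  have key := eventually_eq_zero_of_qDifference (q := q) (μ := q ^ (m + 1) * μ)
    (h := fun z => z ^ (m + 1) * h z) hq hq1 (mul_ne_zero (pow_ne_zero _ hq) hμ0) ?_ ?_ ?_ ?_
  · intro z hz
    have : (fun z => z ^ (m + 1) * h z) z = (fun _ => (0 : ℂ)) z :=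
      eq_of_eventually_eq_nhdsNE (((continuous_pow _).continuousAt).mul (ha z hz).continuousAt)
        continuousAt_const (key z hz)
    exact (mul_eq_zero.1 this).resolve_left (pow_ne_zero _ hz)
  · intro n _ hn
    refine hμ (n - (m + 1 : ℕ)) ?_
    rw [zpow_sub₀ hq, zpow_natCast, zpow_natCast, ← hn]
    field_simp
  · intro z hz
    exact (((analyticAt_id).pow _).mul (ha z hz)).meromorphicAt
  · refine IsBigO.of_bound M ?_
    rw [eventually_nhdsWithin_iff, Metric.eventually_nhds_iff]
    exact ⟨1, one_pos, fun z hz1 hz => hbound z hz (by simpa using hz1.le)⟩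
  · intro z hz
    filter_upwards [eventually_ne_zero_nhdsNE hz] with w hw
    rw [he w hw]
    ring

/-! ### The theta function -/

lemma summable_norm_neg_mul_pow {q : ℂ} (hq1 : ‖q‖ < 1) (z : ℂ) :
    Summable fun n : ℕ => ‖-(z * q ^ n)‖ := by
  simpa [norm_mul, norm_pow] using
    (summable_geometric_of_lt_one (norm_nonneg q) hq1).mul_left ‖z‖

lemma multipliable_one_sub_mul_pow {q : ℂ} (hq1 : ‖q‖ < 1) (z : ℂ) :
    Multipliable fun n : ℕ => 1 - z * q ^ n := by
  simpa [sub_eq_add_neg] using multipliable_one_add_of_summable (summable_norm_neg_mul_pow hq1 z)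

lemma differentiable_qPoch {q : ℂ} (hq1 : ‖q‖ < 1) : Differentiable ℂ fun z => qPoch z q := by
  intro z₀
  set R : ℝ := ‖z₀‖ + 1
  have hprod : HasProdLocallyUniformlyOn (fun (n : ℕ) (z : ℂ) => 1 + -(z * q ^ n))
      (fun z => ∏' n : ℕ, (1 + -(z * q ^ n))) (Metric.ball 0 R) := by
    refine Summable.hasProdLocallyUniformlyOn_nat_one_add (u := fun n => R * ‖q‖ ^ n)
      Metric.isOpen_ball ((summable_geometric_of_lt_one (norm_nonneg q) hq1).mul_left R)
      (.of_forall fun n z hz => ?_) fun n => by fun_prop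
    rw [norm_neg, norm_mul, norm_pow]
    have : ‖z‖ ≤ R := by simpa using (Metric.mem_ball.1 hz).le
    gcongr
  have hd := hprod.differentiableOn (.of_forall fun s => by
    simpa [Finset.prod_fn] using DifferentiableOn.finsetProd (fun _ _ => by fun_prop))
    Metric.isOpen_ball
  have := hd.differentiableAt (Metric.isOpen_ball.mem_nhds (x := z₀) (by simp [R]))
  simpa only [qPoch, sub_eq_add_neg] using this

lemma qPoch_eq_one_sub_mul {q : ℂ} (hq1 : ‖q‖ < 1) (z : ℂ) :
    qPoch z q = (1 - z) * qPoch (q * z) q := by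
  have hshift : (fun n : ℕ => 1 - z * q ^ (n + 1)) = fun n : ℕ => 1 - q * z * q ^ n := by
    ext n
    ring
  have hm : Multipliable fun n : ℕ => 1 - z * q ^ (n + 1) :=
    hshift ▸ multipliable_one_sub_mul_pow hq1 (q * z)
  have h := tprod_eq_zero_mul' (f := fun n : ℕ => 1 - z * q ^ n) hm
  rw [hshift] at h
  simpa only [qPoch, pow_zero, mul_one] using h

lemma qPoch_ne_zero {q z : ℂ} (hq1 : ‖q‖ < 1) (hz : ∀ n : ℕ, z * q ^ n ≠ 1) : qPoch z q ≠ 0 := by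
  have := tprod_one_add_ne_zero_of_summable (f := fun n : ℕ => -(z * q ^ n)) ?_
    (summable_norm_neg_mul_pow hq1 z)
  · simpa [qPoch, sub_eq_add_neg] using this
  · intro n h
    exact hz n (by linear_combination -h)

lemma analyticAt_qPoch {q : ℂ} (hq1 : ‖q‖ < 1) (z : ℂ) : AnalyticAt ℂ (fun z => qPoch z q) z :=
  (differentiable_qPoch hq1).analyticAt z

lemma analyticAt_theta {q : ℂ} (hq1 : ‖q‖ < 1) {z : ℂ} (hz : z ≠ 0) : AnalyticAt ℂ (theta q) z :=
  (analyticAt_qPoch hq1 z).mul <| AnalyticAt.fun_comp (analyticAt_qPoch hq1 (q / z))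
    (analyticAt_const.div analyticAt_id hz)

/-- The theta function with its zero at `z = 1` split off. -/
lemma theta_eq_one_sub_mul {q : ℂ} (hq1 : ‖q‖ < 1) (z : ℂ) :
    theta q z = (1 - z) * (qPoch (q * z) q * qPoch (q / z) q) := by
  rw [theta, qPoch_eq_one_sub_mul hq1 z, mul_assoc]

lemma theta_one {q : ℂ} (hq1 : ‖q‖ < 1) : theta q 1 = 0 := by simp [theta_eq_one_sub_mul hq1]

lemma theta_mul {q z : ℂ} (hq : q ≠ 0) (hq1 : ‖q‖ < 1) (hz : z ≠ 0) :
    theta q (q * z) = -z⁻¹ * theta q z := by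
  have h1 : q / (q * z) = z⁻¹ := by field_simp
  have h2 : q * z⁻¹ = q / z := rfl
  rw [theta_eq_one_sub_mul hq1 z, theta, h1, qPoch_eq_one_sub_mul hq1 z⁻¹, h2]
  field_simp
  ring

lemma theta_div {q z : ℂ} (hq : q ≠ 0) : theta q (q / z) = theta q z := by
  rw [theta, theta, div_div_cancel₀ hq, mul_comm]

lemma theta_inv {q z : ℂ} (hq : q ≠ 0) (hq1 : ‖q‖ < 1) (hz : z ≠ 0) :
    theta q z⁻¹ = -z⁻¹ * theta q z := by
  have h := theta_mul hq hq1 (inv_ne_zero hz)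
  rw [← div_eq_mul_inv, theta_div hq, inv_inv] at h
  rw [h]
  field_simp

lemma theta_ne_zero {q z : ℂ} (hq1 : ‖q‖ < 1) (hz : z ≠ 0)
    (hzq : ∀ n : ℤ, z ≠ q ^ n) : theta q z ≠ 0 := by
  refine mul_ne_zero (qPoch_ne_zero hq1 fun n h => ?_) (qPoch_ne_zero hq1 fun n h => ?_)
  · refine hzq (-n) ?_
    rw [zpow_neg, zpow_natCast]
    exact eq_inv_of_mul_eq_one_left h
  · refine hzq (n + 1 : ℕ) ?_
    rw [zpow_natCast, pow_succ']
    field_simp at h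
    exact h.symm

lemma neg_one_ne_zpow {q : ℂ} (hq1 : ‖q‖ < 1) (n : ℤ) : (-1 : ℂ) ≠ q ^ n := by
  intro h
  have h1 : ‖q‖ ^ n = 1 := by rw [← norm_zpow, ← h]; simp
  rw [zpow_eq_one_iff_right₀ (norm_nonneg q) hq1.ne] at h1
  subst h1
  norm_num at h

lemma iff_zpow_mul_of_iff_mul {q : ℂ} (hq : q ≠ 0) {P : ℂ → Prop}
    (hP : ∀ z ≠ 0, P (q * z) ↔ P z) (n : ℤ) : ∀ z ≠ 0, (P (q ^ n * z) ↔ P z) := by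
  induction n with
  | zero => simp
  | succ n ih =>
    intro z hz
    rw [zpow_add_one₀ hq, mul_assoc, ih _ (mul_ne_zero hq hz), hP z hz]
  | pred n ih =>
    intro z hz
    rw [zpow_sub_one₀ hq, mul_assoc, ih _ (mul_ne_zero (inv_ne_zero hq) hz),
      ← hP _ (mul_ne_zero (inv_ne_zero hq) hz), mul_inv_cancel_left₀ hq]

lemma qPoch_mul_qPoch_one_ne_zero {q : ℂ} (hq1 : ‖q‖ < 1) :
    qPoch (q * 1) q * qPoch (q / 1) q ≠ 0 := by
  have h : qPoch q q ≠ 0 := qPoch_ne_zero hq1 fun n h => by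
    have h1 : ‖q‖ ^ (n + 1) = 1 := by rw [← norm_pow, pow_succ', h, norm_one]
    exact absurd h1 (pow_lt_one₀ (norm_nonneg q) hq1 n.succ_ne_zero).ne
  simpa using h

lemma continuousAt_qPoch_mul_qPoch {q : ℂ} (hq1 : ‖q‖ < 1) {z : ℂ} (hz : z ≠ 0) :
    ContinuousAt (fun z => qPoch (q * z) q * qPoch (q / z) q) z := by
  have hc := (differentiable_qPoch hq1).continuous
  exact (hc.comp (continuous_const_mul q)).continuousAt.mul
    (ContinuousAt.comp (f := fun z => q / z) hc.continuousAt
      (continuousAt_const.div continuousAt_id hz))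

lemma eventually_theta_ne_zero {q : ℂ} (hq : q ≠ 0) (hq1 : ‖q‖ < 1) {z₀ : ℂ} (hz₀ : z₀ ≠ 0) :
    ∀ᶠ z in 𝓝[≠] z₀, theta q z ≠ 0 := by
  by_cases hzq : ∀ n : ℤ, z₀ ≠ q ^ n
  · exact ((analyticAt_theta hq1 hz₀).continuousAt.eventually_ne
      (theta_ne_zero hq1 hz₀ hzq)).filter_mono nhdsWithin_le_nhds
  push Not at hzq
  obtain ⟨n, rfl⟩ := hzq
  have h1 : ∀ᶠ z in 𝓝[≠] (1 : ℂ), theta q z ≠ 0 := by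
    filter_upwards [self_mem_nhdsWithin,
      ((continuousAt_qPoch_mul_qPoch hq1 one_ne_zero).eventually_ne
        (qPoch_mul_qPoch_one_ne_zero hq1)).filter_mono nhdsWithin_le_nhds] with z hz hz'
    rw [theta_eq_one_sub_mul hq1]
    exact mul_ne_zero (sub_ne_zero.2 (Ne.symm hz)) hz'
  have := (iff_zpow_mul_of_iff_mul (P := fun z₀ => ∀ᶠ z in 𝓝[≠] z₀, theta q z ≠ 0) hq ?_ n 1
    one_ne_zero).2 h1
  · simpa using this
  · intro z₀ hz₀
    constructor
    · intro h
      filter_upwards [(tendsto_const_mul_nhdsNE hq z₀).eventually h,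
        eventually_ne_zero_nhdsNE hz₀] with z hz hz0
      rw [theta_mul hq hq1 hz0] at hz
      exact right_ne_zero_of_mul hz
    · intro h
      refine eventually_nhdsNE_mul hq ?_
      filter_upwards [h, eventually_ne_zero_nhdsNE hz₀] with z hz hz0
      rw [theta_mul hq hq1 hz0]
      exact mul_ne_zero (neg_ne_zero.2 (inv_ne_zero hz0)) hz

/-- A theta function that vanishes at as many incongruent points as its degree is a multiple of
`∏ i, θ(z / y i)`; it vanishes if its multiplier is not, up to powers of `q`, the one prescribed
by the zeros. The reason is that its quotient by the product has no poles. -/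
theorem eq_zero_of_theta_zeros {q μ : ℂ} (hq : q ≠ 0) (hq1 : ‖q‖ < 1) (hμ0 : μ ≠ 0)
    (hμ : ∀ n : ℤ, μ ≠ q ^ n) {ι : Type*} [Fintype ι] {y : ι → ℂ} (hy : ∀ i, y i ≠ 0)
    (hyy : ∀ i j, i ≠ j → ∀ n : ℤ, y i / y j ≠ q ^ n) {F : ℂ → ℂ}
    (ha : ∀ z ≠ 0, AnalyticAt ℂ F z) (hF : ∀ i, F (y i) = 0)
    (he : ∀ z ≠ 0, F (q * z) = μ * (∏ i, -(y i / z)) * F z) : ∀ z ≠ 0, F z = 0 := by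
  classical
  have hdiv : ∀ i (z : ℂ), z ≠ 0 → z / y i ≠ 0 := fun i z hz => div_ne_zero hz (hy i)
  have hfac : ∀ i, ∀ z ≠ 0, AnalyticAt ℂ (fun z => theta q (z / y i)) z := fun i z hz =>
    AnalyticAt.fun_comp (analyticAt_theta hq1 (hdiv i z hz)) (analyticAt_id.div_const)
  set P : ℂ → ℂ := fun z => ∏ i, theta q (z / y i) with hP
  have hPa : ∀ z ≠ 0, AnalyticAt ℂ P z := fun z hz =>
    Finset.analyticAt_fun_prod _ fun i _ => hfac i z hz
  have hPq : ∀ z ≠ 0, P (q * z) = (∏ i, -(y i / z)) * P z := by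
    intro z hz
    simp only [hP]
    rw [← Finset.prod_mul_distrib]
    refine Finset.prod_congr rfl fun i _ => ?_
    rw [mul_div_assoc, theta_mul hq hq1 (hdiv i z hz), inv_div]
  have hPne : ∀ z₀ ≠ 0, ∀ᶠ z in 𝓝[≠] z₀, P z ≠ 0 := by
    intro z₀ hz₀
    have : ∀ i, ∀ᶠ z in 𝓝[≠] z₀, theta q (z / y i) ≠ 0 := fun i => by
      have ht := tendsto_const_mul_nhdsNE (inv_ne_zero (hy i)) z₀
      simpa only [div_eq_inv_mul] using ht.eventually
        (eventually_theta_ne_zero hq hq1 (mul_ne_zero (inv_ne_zero (hy i)) hz₀))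
    filter_upwards [eventually_all.2 this] with z hz
    exact Finset.prod_ne_zero_iff.2 fun i _ => hz i
  set h : ℂ → ℂ := fun z => F z / P z with hh
  have hhq : ∀ z ≠ 0, h (q * z) = μ * h z := by
    intro z hz
    have : ∏ i, -(y i / z) ≠ 0 :=
      Finset.prod_ne_zero_iff.2 fun i _ => neg_ne_zero.2 (div_ne_zero (hy i) hz)
    simp only [hh]
    rw [he z hz, hPq z hz, mul_comm μ, mul_assoc, mul_div_mul_left _ _ this, mul_div_assoc]
  have hbq : ∀ z ≠ 0, BoundedNear h (q * z) ↔ BoundedNear h z := by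
    intro z hz
    constructor
    · intro hb
      refine ((BoundedNear.of_continuousAt (continuousAt_const (y := μ⁻¹))).mul
        (hb.comp_const_mul hq)).congr ?_
      filter_upwards [eventually_ne_zero_nhdsNE hz] with w hw
      rw [hhq w hw, inv_mul_cancel_left₀ hμ0]
    · intro hb
      refine BoundedNear.of_comp_const_mul hq
        (((BoundedNear.of_continuousAt (continuousAt_const (y := μ))).mul hb).congr ?_)
      filter_upwards [eventually_ne_zero_nhdsNE hz] with w hw
      rw [hhq w hw]
  have hby : ∀ i, BoundedNear h (y i) := by
    intro i
    have hO : F =O[𝓝[≠] (y i)] fun z => z - y i := by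
      have := (ha _ (hy i)).differentiableAt.isBigO_sub
      simp only [hF i, sub_zero] at this
      exact this.mono nhdsWithin_le_nhds
    have h1 : BoundedNear (fun z => F z / (1 - z / y i)) (y i) := by
      obtain ⟨C, hC⟩ := hO.bound
      refine IsBigO.of_bound (C * ‖y i‖) ?_
      filter_upwards [hC, self_mem_nhdsWithin] with z hz hz'
      have hsub : z - y i ≠ 0 := sub_ne_zero.2 hz'
      have e : 1 - z / y i = -((z - y i) / y i) := by field_simp [hy i]; ring
      rw [e, norm_div, norm_neg, norm_div, norm_one, mul_one, div_le_iff₀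
        (div_pos (norm_pos_iff.2 hsub) (norm_pos_iff.2 (hy i)))]
      have : ‖y i‖ ≠ 0 := norm_ne_zero_iff.2 (hy i)
      calc ‖F z‖ ≤ C * ‖z - y i‖ := hz
        _ = C * ‖y i‖ * (‖z - y i‖ / ‖y i‖) := by field_simp
    set Q : ℂ → ℂ := fun z => (qPoch (q * (z / y i)) q * qPoch (q / (z / y i)) q) *
      ∏ j ∈ Finset.univ.erase i, theta q (z / y j) with hQ
    have hQc : ContinuousAt Q (y i) := by
      refine ContinuousAt.mul ?_ ?_
      · exact ContinuousAt.comp (f := fun z => z / y i)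
          (continuousAt_qPoch_mul_qPoch hq1 (hdiv i _ (hy i)))
          (continuousAt_id.div_const _)
      · exact (Finset.analyticAt_fun_prod _ fun j _ => hfac j _ (hy i)).continuousAt
    have hQ0 : Q (y i) ≠ 0 := by
      refine mul_ne_zero ?_ (Finset.prod_ne_zero_iff.2 fun j hj => ?_)
      · rw [div_self (hy i)]
        exact qPoch_mul_qPoch_one_ne_zero hq1
      · exact theta_ne_zero hq1 (hdiv j _ (hy i)) (hyy i j (Finset.ne_of_mem_erase hj).symm)
    refine (h1.mul (BoundedNear.of_continuousAt (hQc.inv₀ hQ0))).congr (.of_forall fun z => ?_)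
    have hPQ : P z = (1 - z / y i) * Q z := by
      simp only [hP, hQ]
      rw [← Finset.mul_prod_erase _ _ (Finset.mem_univ i), theta_eq_one_sub_mul hq1 (z / y i)]
      ring
    simp only [hh, Pi.inv_apply]
    rw [hPQ, ← div_eq_mul_inv, div_div]
  have hb : ∀ z ≠ 0, BoundedNear h z := by
    intro z hz
    by_cases hPz : P z = 0
    · obtain ⟨i, -, hi⟩ := Finset.prod_eq_zero_iff.1 hPz
      have : ∃ n : ℤ, z / y i = q ^ n := by
        by_contra! hn
        exact theta_ne_zero hq1 (hdiv i z hz) hn hi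
      obtain ⟨n, hn⟩ := this
      rw [div_eq_iff (hy i)] at hn
      rw [hn]
      exact (iff_zpow_mul_of_iff_mul hq hbq n _ (hy i)).2 (hby i)
    · exact BoundedNear.of_continuousAt ((ha z hz).continuousAt.div (hPa z hz).continuousAt hPz)
  obtain ⟨k, hk, hhk⟩ := exists_analyticAt_of_boundedNear (h := h)
    (fun z hz => (ha z hz).meromorphicAt.div (hPa z hz).meromorphicAt) hb
  have hkq := qDifference_of_eventually_eq hq hk hhk fun z hz =>
    (eventually_ne_zero_nhdsNE hz).mono fun w hw => hhq w hw
  have hk0 := eq_zero_of_qDifference_of_analytic hq hq1 hμ0 hμ hk hkq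
  intro z hz
  refine eq_of_eventually_eq_nhdsNE (k := fun _ => 0) (ha z hz).continuousAt continuousAt_const ?_
  filter_upwards [hhk z hz, hPne z hz, eventually_ne_zero_nhdsNE hz] with w e hP hw
  rw [hk0 w hw] at e
  exact (div_eq_zero_iff.1 e).resolve_right hP

/-! ### Cubic theta functions attached to points of the forbidden curve -/

lemma evalPoint_zero (q : ℂ) (a : Fin 3 → ℂ) : evalPoint q a 0 = (a 0)⁻¹ := rfl

lemma evalPoint_one (q : ℂ) (a : Fin 3 → ℂ) : evalPoint q a 1 = a 1 / q := rfl

lemma evalPoint_two (q : ℂ) (a : Fin 3 → ℂ) : evalPoint q a 2 = q⁻¹ := rfl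

lemma IsParameter.evalPoint_ne_zero {q : ℂ} {a : Fin 3 → ℂ} (hqa : IsParameter q a) (k : Fin 3) :
    evalPoint q a k ≠ 0 := by
  fin_cases k
  · exact inv_ne_zero (hqa.a_ne_zero 0)
  · exact div_ne_zero (hqa.a_ne_zero 1) hqa.q_ne_zero
  · exact inv_ne_zero hqa.q_ne_zero

/-- The constant `x₁ x₂ x₃ = (q a₀² a₂)⁻¹` in the `q`-difference equation of the connection
matrix. -/
def multiplier (q : ℂ) (a : Fin 3 → ℂ) : ℂ := (q * a 0 ^ 2 * a 2)⁻¹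

lemma IsParameter.multiplier_eq_prod {q : ℂ} {a : Fin 3 → ℂ} (hqa : IsParameter q a) :
    multiplier q a = evalPoint q a 0 * evalPoint q a 1 * evalPoint q a 2 := by
  have hq := hqa.q_ne_zero
  have h0 := hqa.a_ne_zero 0
  have h2 := hqa.a_ne_zero 2
  simp only [multiplier, evalPoint_zero, evalPoint_one, evalPoint_two]
  field_simp
  linear_combination -hqa.prod_a

lemma IsParameter.evalPoint_div {q : ℂ} {a : Fin 3 → ℂ} (hqa : IsParameter q a) :
    evalPoint q a 0 / evalPoint q a 1 = a 2 ∧ evalPoint q a 0 / evalPoint q a 2 = q / a 0 ∧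
      evalPoint q a 1 / evalPoint q a 2 = a 1 := by
  have hq := hqa.q_ne_zero
  have h0 := hqa.a_ne_zero 0
  have h1 := hqa.a_ne_zero 1
  simp only [evalPoint_zero, evalPoint_one, evalPoint_two]
  refine ⟨?_, ?_, ?_⟩
  · field_simp
    linear_combination -hqa.prod_a
  · field_simp
  · field_simp

lemma evalPoint_div_ne_zpow {q : ℂ} {a : Fin 3 → ℂ} (hqa : IsParameter q a)
    (hres : NonResonant q a) {i j : Fin 3} (hij : i ≠ j) (n : ℤ) :
    evalPoint q a i / evalPoint q a j ≠ q ^ n ∧ evalPoint q a i / evalPoint q a j ≠ -q ^ n := by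
  have hq := hqa.q_ne_zero
  have hinv : ∀ {w : ℂ}, (∀ n : ℤ, w ≠ q ^ n ∧ w ≠ -q ^ n) →
      ∀ n : ℤ, w⁻¹ ≠ q ^ n ∧ w⁻¹ ≠ -q ^ n := by
    intro w hw n
    constructor
    · intro h
      exact (hw (-n)).1 (by rw [zpow_neg, ← h, inv_inv])
    · intro h
      exact (hw (-n)).2 (by rw [zpow_neg, ← inv_neg, ← h, inv_inv])
  obtain ⟨e01, e02, e12⟩ := hqa.evalPoint_div
  have h01 : ∀ n : ℤ, evalPoint q a 0 / evalPoint q a 1 ≠ q ^ n ∧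
      evalPoint q a 0 / evalPoint q a 1 ≠ -q ^ n := e01 ▸ hres 2
  have h12 : ∀ n : ℤ, evalPoint q a 1 / evalPoint q a 2 ≠ q ^ n ∧
      evalPoint q a 1 / evalPoint q a 2 ≠ -q ^ n := e12 ▸ hres 1
  have h02 : ∀ n : ℤ, evalPoint q a 0 / evalPoint q a 2 ≠ q ^ n ∧
      evalPoint q a 0 / evalPoint q a 2 ≠ -q ^ n := by
    rw [e02]
    intro n
    have h := hinv (hres 0) (n - 1)
    rw [zpow_sub_one₀ hq] at h
    constructor
    · intro e
      exact h.1 (by rw [← e]; field_simp)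
    · intro e
      exact h.2 (by rw [← neg_mul, ← e]; field_simp)
  have h10 := hinv h01
  have h20 := hinv h02
  have h21 := hinv h12
  rw [inv_div] at h10 h20 h21
  fin_cases i <;> fin_cases j
  · exact absurd rfl hij
  · exact h01 n
  · exact h02 n
  · exact h10 n
  · exact absurd rfl hij
  · exact h12 n
  · exact h20 n
  · exact h21 n
  · exact absurd rfl hij

/-- The zeros `±x_k` of the determinant of the connection matrix. -/
def detZero (q : ℂ) (a : Fin 3 → ℂ) : Fin 3 ⊕ Fin 3 → ℂ :=
  Sum.elim (evalPoint q a) fun k => -evalPoint q a k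

lemma detZero_div_ne_zpow {q : ℂ} {a : Fin 3 → ℂ} (hqa : IsParameter q a)
    (hres : NonResonant q a) (i j : Fin 3 ⊕ Fin 3) (hij : i ≠ j) (n : ℤ) :
    detZero q a i / detZero q a j ≠ q ^ n := by
  have hneg : ∀ i j : Fin 3, -(evalPoint q a i / evalPoint q a j) ≠ q ^ n := by
    intro i j
    rcases eq_or_ne i j with rfl | hij
    · rw [div_self (hqa.evalPoint_ne_zero i)]
      exact neg_one_ne_zpow hqa.norm_q_lt_one n
    · intro h
      exact (evalPoint_div_ne_zpow hqa hres hij n).2 (by rw [← h, neg_neg])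
  rcases i with i | i <;> rcases j with j | j
  · exact (evalPoint_div_ne_zpow hqa hres (fun h => hij (congrArg _ h)) n).1
  · simpa [detZero, div_neg] using hneg i j
  · simpa [detZero, neg_div] using hneg i j
  · simpa [detZero] using (evalPoint_div_ne_zpow hqa hres (fun h => hij (congrArg _ h)) n).1

/-- The theta functions `θ(s₁ z / x₁) θ(s₂ z / x₂) θ(s₃ z / x₃)`. For signs with product `-1` they
have the multiplier of the first column of a connection matrix at time `t = 1`. -/
def cubicTheta (q : ℂ) (a : Fin 3 → ℂ) (s : Fin 3 → ℂ) (z : ℂ) : ℂ :=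
  ∏ k, theta q (s k * (z / evalPoint q a k))

lemma analyticAt_cubicTheta {q : ℂ} {a : Fin 3 → ℂ} (hqa : IsParameter q a) {s : Fin 3 → ℂ}
    (hs : ∀ k, s k ≠ 0) {z : ℂ} (hz : z ≠ 0) : AnalyticAt ℂ (cubicTheta q a s) z :=
  Finset.analyticAt_fun_prod _ fun k _ => AnalyticAt.fun_comp
    (analyticAt_theta hqa.norm_q_lt_one
      (mul_ne_zero (hs k) (div_ne_zero hz (hqa.evalPoint_ne_zero k))))
    (analyticAt_const.mul analyticAt_id.div_const)

lemma cubicTheta_mul {q : ℂ} {a : Fin 3 → ℂ} (hqa : IsParameter q a) {s : Fin 3 → ℂ}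
    (hs : s 0 * s 1 * s 2 = -1) {z : ℂ} (hz : z ≠ 0) :
    cubicTheta q a s (q * z) = multiplier q a * (z ^ 3)⁻¹ * cubicTheta q a s z := by
  have h01 : s 0 * s 1 ≠ 0 := left_ne_zero_of_mul (b := s 2) (by rw [hs]; norm_num)
  have h0 : s 0 ≠ 0 := left_ne_zero_of_mul h01
  have h1 : s 1 ≠ 0 := right_ne_zero_of_mul h01
  have h2 : s 2 ≠ 0 := right_ne_zero_of_mul (a := s 0 * s 1) (by rw [hs]; norm_num)
  have key : ∀ k, s k ≠ 0 → theta q (s k * (q * z / evalPoint q a k)) =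
      -(s k * (z / evalPoint q a k))⁻¹ * theta q (s k * (z / evalPoint q a k)) := by
    intro k hk
    rw [← theta_mul hqa.q_ne_zero hqa.norm_q_lt_one
      (mul_ne_zero hk (div_ne_zero hz (hqa.evalPoint_ne_zero k)))]
    congr 1
    ring
  simp only [cubicTheta, Fin.prod_univ_three]
  rw [key 0 h0, key 1 h1, key 2 h2, hqa.multiplier_eq_prod]
  have e : (s 0)⁻¹ * (s 1)⁻¹ * (s 2)⁻¹ = -1 := by rw [← mul_inv, ← mul_inv, hs]; norm_num
  simp only [mul_inv, inv_div]
  linear_combination (-(evalPoint q a 0 / z) * (evalPoint q a 1 / z) * (evalPoint q a 2 / z) *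
    theta q (s 0 * (z / evalPoint q a 0)) * theta q (s 1 * (z / evalPoint q a 1)) *
    theta q (s 2 * (z / evalPoint q a 2))) * e

/-- For a point `p` of the forbidden curve there is a non-zero theta function `g` such that
`(g(z), g(-z))` satisfies, at time `t = 1`, all conditions on a column of a connection matrix with
monodromy coordinates `p`. In a basis adapted to the points `x_k`, the determinant of the three
linear conditions at these points is a multiple of the second equation of the curve. -/
theorem exists_theta_of_forbidden {q : ℂ} {a : Fin 3 → ℂ} (hqa : IsParameter q a)
    (hres : NonResonant q a) {p : Fin 3 → CP1} (hp : OnForbiddenCurve q a p) :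
    ∃ g : ℂ → ℂ, (∀ z ≠ 0, AnalyticAt ℂ g z) ∧
      (∀ z ≠ 0, g (q * z) = multiplier q a * (z ^ 3)⁻¹ * g z) ∧
      (∀ k, den (p k) * g (evalPoint q a k) = num (p k) * g (-evalPoint q a k)) ∧
      ∃ z ≠ 0, g z ≠ 0 := by
  have hq := hqa.q_ne_zero
  have hq1 := hqa.norm_q_lt_one
  have ha0 := hqa.a_ne_zero 0
  have ha1 := hqa.a_ne_zero 1
  have ha2 := hqa.a_ne_zero 2
  set x := evalPoint q a with hx
  have hx0 : ∀ k, x k ≠ 0 := hqa.evalPoint_ne_zero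
  set s : Fin 3 → Fin 3 → ℂ := fun j k => if k = j then -1 else 1 with hs
  have hs0 : ∀ j k, s j k ≠ 0 := by
    intro j k
    simp only [hs]
    split_ifs <;> norm_num
  have hsp : ∀ j, s j 0 * s j 1 * s j 2 = -1 := by
    intro j
    fin_cases j <;> simp [hs]
  set G : Fin 3 → ℂ → ℂ := fun j => cubicTheta q a (s j) with hG
  have hth1 := theta_one hq1
  -- `G j` vanishes at the points `x k` with `k ≠ j` and at `-x j`.
  have hGx : ∀ j k, j ≠ k → G j (x k) = 0 := by
    intro j k hjk
    refine Finset.prod_eq_zero (Finset.mem_univ k) ?_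
    rw [← hx, div_self (hx0 k)]
    simp [hs, hjk.symm, hth1]
  have hGn : ∀ j, G j (-x j) = 0 := by
    intro j
    refine Finset.prod_eq_zero (Finset.mem_univ j) ?_
    rw [← hx, neg_div, div_self (hx0 j)]
    simp [hs, hth1]
  have hGd : ∀ j, G j (x j) ≠ 0 := by
    intro j
    refine Finset.prod_ne_zero_iff.2 fun k _ => ?_
    refine theta_ne_zero hq1 (mul_ne_zero (hs0 j k) (div_ne_zero (hx0 j) (hx0 k))) fun n => ?_
    rcases eq_or_ne k j with rfl | hkj
    · rw [← hx, div_self (hx0 k)]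
      simpa [hs] using neg_one_ne_zpow hq1 n
    · simpa [hs, hkj] using (evalPoint_div_ne_zpow hqa hres hkj.symm n).1
  -- The values at `±x k` in terms of `θ(-1)` and `θ(±a k)`.
  obtain ⟨e01, e02, e12⟩ := hqa.evalPoint_div
  rw [← hx] at e01 e02 e12
  have e10 : x 1 / x 0 = (a 2)⁻¹ := by rw [← e01, inv_div]
  have e20 : x 2 / x 0 = (q / a 0)⁻¹ := by rw [← e02, inv_div]
  have e21 : x 2 / x 1 = (a 1)⁻¹ := by rw [← e12, inv_div]
  have ti : ∀ w : ℂ, w ≠ 0 → theta q w⁻¹ = -w⁻¹ * theta q w := fun w hw => theta_inv hq hq1 hw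
  have tn : ∀ w : ℂ, w ≠ 0 → theta q (-w⁻¹) = w⁻¹ * theta q (-w) := fun w hw => by
    have := theta_inv hq hq1 (neg_ne_zero.2 hw)
    rwa [inv_neg, neg_neg] at this
  have td : theta q (-(q / a 0)) = theta q (-a 0) := by
    rw [← div_neg, theta_div hq]
  have hqa0 : q / a 0 ≠ 0 := div_ne_zero hq ha0
  have v00 : G 0 (x 0) = theta q (-1) * theta q (a 2) * theta q (a 0) := by
    simp [hG, cubicTheta, Fin.prod_univ_three, hs, ← hx, e01, e02, div_self (hx0 0),
      theta_div hq]
  have v01 : G 0 (-x 1) = -(a 2)⁻¹ * theta q (a 2) * theta q (-1) * theta q (-a 1) := by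
    simp [hG, cubicTheta, Fin.prod_univ_three, hs, ← hx, neg_div, e10, e12, div_self (hx0 1),
      ti _ ha2]
  have v02 : G 0 (-x 2) = -(q / a 0)⁻¹ * theta q (a 0) * ((a 1)⁻¹ * theta q (-a 1)) *
      theta q (-1) := by
    simp only [hG, cubicTheta, Fin.prod_univ_three, hs, ← hx, neg_div, e20, e21, div_self (hx0 2)]
    simp [tn _ ha1, -inv_div, ti _ hqa0, theta_div hq]
  have v11 : G 1 (x 1) = theta q (-1) * (-(a 2)⁻¹ * theta q (a 2)) * theta q (a 1) := by
    simp [hG, cubicTheta, Fin.prod_univ_three, hs, ← hx, e10, e12, div_self (hx0 1),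
      ti _ ha2, -mul_eq_mul_right_iff]
    ring
  have v10 : G 1 (-x 0) = theta q (-1) * theta q (a 2) * theta q (-a 0) := by
    simp [hG, cubicTheta, Fin.prod_univ_three, hs, ← hx, neg_div, e01, e02, div_self (hx0 0), td]
  have v12 : G 1 (-x 2) = (q / a 0)⁻¹ * theta q (-a 0) * (-(a 1)⁻¹ * theta q (a 1)) *
      theta q (-1) := by
    simp only [hG, cubicTheta, Fin.prod_univ_three, hs, ← hx, neg_div, e20, e21, div_self (hx0 2)]
    simp [ti _ ha1, -inv_div, tn _ hqa0, td]
  have v22 : G 2 (x 2) = theta q (-1) * ((q / a 0)⁻¹ * theta q (a 0)) *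
      ((a 1)⁻¹ * theta q (a 1)) := by
    simp only [hG, cubicTheta, Fin.prod_univ_three, hs, ← hx, e20, e21, div_self (hx0 2)]
    simp [ti _ ha1, -inv_div, ti _ hqa0, theta_div hq]
    ring
  have v20 : G 2 (-x 0) = theta q (-a 2) * theta q (a 0) * theta q (-1) := by
    simp [hG, cubicTheta, Fin.prod_univ_three, hs, ← hx, neg_div, e01, e02, div_self (hx0 0),
      theta_div hq]
    ring
  have v21 : G 2 (-x 1) = (a 2)⁻¹ * theta q (-a 2) * theta q (a 1) * theta q (-1) := by
    simp [hG, cubicTheta, Fin.prod_univ_three, hs, ← hx, neg_div, e10, e12, div_self (hx0 1),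
      tn _ ha2]
    ring
  set M : Matrix (Fin 3) (Fin 3) ℂ := Matrix.of fun k j =>
    den (p k) * G j (x k) - num (p k) * G j (-x k) with hM
  have hdet : M.det = 0 := by
    have h2 := hp.2
    simp only [beta, Matrix.cons_val] at h2
    rw [Matrix.det_fin_three]
    simp only [hM, Matrix.of_apply, hGn, hGx 0 1 (by decide), hGx 0 2 (by decide),
      hGx 1 0 (by decide), hGx 1 2 (by decide), hGx 2 0 (by decide), hGx 2 1 (by decide),
      v00, v01, v02, v10, v11, v12, v20, v21, v22]
    linear_combination (-(theta q (-1)) ^ 3 * (a 2)⁻¹ * (a 1)⁻¹ * (q / a 0)⁻¹ *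
      theta q (a 0) * theta q (a 1) * theta q (a 2)) * h2
  obtain ⟨c, hc0, hc⟩ := Matrix.exists_mulVec_eq_zero_iff.2 hdet
  refine ⟨fun z => ∑ j, c j * G j z, fun z hz => ?_, fun z hz => ?_, fun k => ?_, ?_⟩
  · exact Finset.analyticAt_fun_sum _ fun j _ =>
      analyticAt_const.mul (analyticAt_cubicTheta hqa (hs0 j) hz)
  · rw [Finset.mul_sum]
    refine Finset.sum_congr rfl fun j _ => ?_
    simp only [hG]
    rw [cubicTheta_mul hqa (hsp j) hz]
    ring
  · have := congrFun hc k
    simp only [Matrix.mulVec, dotProduct, hM, Matrix.of_apply, Pi.zero_apply] at this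
    rw [← sub_eq_zero, ← this, Finset.mul_sum, Finset.mul_sum, ← Finset.sum_sub_distrib]
    exact Finset.sum_congr rfl fun j _ => by ring
  · obtain ⟨k, hk⟩ := Function.ne_iff.1 hc0
    refine ⟨x k, hx0 k, ?_⟩
    simp only
    rw [Finset.sum_eq_single k (fun j _ hj => by rw [hGx j k hj, mul_zero]) (by simp)]
    exact mul_ne_zero hk (hGd k)

lemma num_ne_zero_or_den_ne_zero (p : CP1) : num p ≠ 0 ∨ den p ≠ 0 := by
  by_contra! h
  refine p.rep_nonzero ?_
  ext i
  fin_cases i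
  · exact h.1
  · exact h.2

/-- A column `(v₀, v₁)` of the connection matrix at time `t`, with `μ = t^{±1} ∉ q^ℤ`, is
proportional to `(g(z), g(-z))`: the determinant of the two vanishes at the six points `±x_k`, but
its multiplier is not the one prescribed by these zeros. -/
theorem column_proportional {q : ℂ} {a : Fin 3 → ℂ} (hqa : IsParameter q a)
    (hres : NonResonant q a) {p : Fin 3 → CP1} {g : ℂ → ℂ} (hg : ∀ z ≠ 0, AnalyticAt ℂ g z)
    (hgq : ∀ z ≠ 0, g (q * z) = multiplier q a * (z ^ 3)⁻¹ * g z)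
    (hgp : ∀ k, den (p k) * g (evalPoint q a k) = num (p k) * g (-evalPoint q a k))
    {μ ε : ℂ} (hμ0 : μ ≠ 0) (hμ : ∀ n : ℤ, μ ≠ q ^ n) {v₀ v₁ : ℂ → ℂ}
    (h0 : ∀ z ≠ 0, AnalyticAt ℂ v₀ z) (h1 : ∀ z ≠ 0, AnalyticAt ℂ v₁ z)
    (h0q : ∀ z ≠ 0, v₀ (q * z) = multiplier q a * (z ^ 3)⁻¹ * μ * v₀ z)
    (h1q : ∀ z ≠ 0, v₁ (q * z) = -(multiplier q a * (z ^ 3)⁻¹ * μ * v₁ z))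
    (h0n : ∀ z ≠ 0, v₀ (-z) = ε * v₁ z) (h1n : ∀ z ≠ 0, v₁ (-z) = ε * v₀ z)
    (hvp : ∀ k, den (p k) * v₀ (evalPoint q a k) = num (p k) * v₁ (evalPoint q a k)) :
    ∀ z ≠ 0, g z * v₁ z = g (-z) * v₀ z := by
  have hq := hqa.q_ne_zero
  have hx0 := hqa.evalPoint_ne_zero
  have hgneg : ∀ z ≠ 0, AnalyticAt ℂ (fun z => g (-z)) z := fun z hz =>
    AnalyticAt.fun_comp (hg _ (neg_ne_zero.2 hz)) analyticAt_id.neg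
  have hx : ∀ k, g (evalPoint q a k) * v₁ (evalPoint q a k) -
      g (-evalPoint q a k) * v₀ (evalPoint q a k) = 0 := by
    intro k
    rcases num_ne_zero_or_den_ne_zero (p k) with h | h
    · refine (mul_eq_zero.1 ?_).resolve_left h
      linear_combination (v₀ (evalPoint q a k)) * (hgp k) - (g (evalPoint q a k)) * hvp k
    · refine (mul_eq_zero.1 ?_).resolve_left h
      linear_combination (v₁ (evalPoint q a k)) * (hgp k) - (g (-evalPoint q a k)) * hvp k
  have key := eq_zero_of_theta_zeros (μ := μ) (y := detZero q a)
    (F := fun z => g z * v₁ z - g (-z) * v₀ z) hq hqa.norm_q_lt_one hμ0 hμ ?_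
    (detZero_div_ne_zpow hqa hres)
    (fun z hz => ((hg z hz).mul (h1 z hz)).sub ((hgneg z hz).mul (h0 z hz))) ?_ ?_
  · exact fun z hz => sub_eq_zero.1 (key z hz)
  · rintro (k | k)
    · exact hx0 k
    · exact neg_ne_zero.2 (hx0 k)
  · rintro (k | k)
    · exact hx k
    · simp only [detZero, Sum.elim_inr, neg_neg]
      rw [h0n _ (hx0 k), h1n _ (hx0 k)]
      linear_combination -ε * hx k
  · intro z hz
    rw [← mul_neg, hgq z hz, hgq _ (neg_ne_zero.2 hz), h0q z hz, h1q z hz,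
      hqa.multiplier_eq_prod]
    simp only [Fintype.prod_sum_type, Fin.prod_univ_three, detZero, Sum.elim_inl, Sum.elim_inr]
    field_simp
    ring

/-- A matrix with the properties of a connection matrix at a time `t ∉ q^ℤ` cannot have monodromy
coordinates on the forbidden curve: both columns would be proportional to the same vector. -/
theorem not_onForbiddenCurve_of_matrix {q : ℂ} {a : Fin 3 → ℂ} (hqa : IsParameter q a)
    (hres : NonResonant q a) {t : ℂ} (ht0 : t ≠ 0) (ht : ∀ n : ℤ, t ≠ q ^ n)
    {C : ℂ → Matrix (Fin 2) (Fin 2) ℂ} (hC : ∀ z ≠ 0, ∀ i j, AnalyticAt ℂ (fun z => C z i j) z)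
    (hCq : ∀ z ≠ 0, C (q * z) =
      (multiplier q a * (z ^ 3)⁻¹) • (!![1, 0; 0, -1] * C z * !![t⁻¹, 0; 0, t]))
    (hCn : ∀ z ≠ 0, C (-z) = -(!![0, 1; 1, 0] * C z * !![1, 0; 0, -1]))
    (hCd : ∀ z₀ ≠ 0, ∀ᶠ z in 𝓝[≠] z₀, (C z).det ≠ 0) {p : Fin 3 → CP1}
    (hp : ∀ k j, den (p k) * C (evalPoint q a k) 0 j = num (p k) * C (evalPoint q a k) 1 j) :
    ¬ OnForbiddenCurve q a p := by
  intro hcurve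
  obtain ⟨g, hg, hgq, hgp, w, hw, hgw⟩ := exists_theta_of_forbidden hqa hres hcurve
  have hti : ∀ n : ℤ, t⁻¹ ≠ q ^ n := fun n h => ht (-n) (by rw [zpow_neg, ← h, inv_inv])
  have c0 := column_proportional hqa hres hg hgq hgp (ε := -1) (inv_ne_zero ht0) hti
    (v₀ := fun z => C z 0 0) (v₁ := fun z => C z 1 0)
    (fun z hz => hC z hz 0 0) (fun z hz => hC z hz 1 0)
    (fun z hz => by simp only [hCq z hz, Matrix.smul_apply, Matrix.mul_apply,
      Fin.sum_univ_two]; simp; ring)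
    (fun z hz => by simp only [hCq z hz, Matrix.smul_apply, Matrix.mul_apply,
      Fin.sum_univ_two]; simp; ring)
    (fun z hz => by simp only [hCn z hz, Matrix.neg_apply, Matrix.mul_apply,
      Fin.sum_univ_two]; simp)
    (fun z hz => by simp only [hCn z hz, Matrix.neg_apply, Matrix.mul_apply,
      Fin.sum_univ_two]; simp)
    (fun k => hp k 0)
  have c1 := column_proportional hqa hres hg hgq hgp (ε := 1) ht0 ht
    (v₀ := fun z => C z 0 1) (v₁ := fun z => C z 1 1)
    (fun z hz => hC z hz 0 1) (fun z hz => hC z hz 1 1)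
    (fun z hz => by simp only [hCq z hz, Matrix.smul_apply, Matrix.mul_apply,
      Fin.sum_univ_two]; simp; ring)
    (fun z hz => by simp only [hCq z hz, Matrix.smul_apply, Matrix.mul_apply,
      Fin.sum_univ_two]; simp; ring)
    (fun z hz => by simp only [hCn z hz, Matrix.neg_apply, Matrix.mul_apply,
      Fin.sum_univ_two]; simp)
    (fun z hz => by simp only [hCn z hz, Matrix.neg_apply, Matrix.mul_apply,
      Fin.sum_univ_two]; simp)
    (fun k => hp k 1)
  have hgne : ∀ᶠ z in 𝓝[≠] w, g z ≠ 0 :=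
    ((hg w hw).continuousAt.eventually_ne hgw).filter_mono nhdsWithin_le_nhds
  obtain ⟨z, ⟨hgz, hdet⟩, hz⟩ :=
    ((hgne.and (hCd w hw)).and (eventually_ne_zero_nhdsNE hw)).exists
  refine hdet ((mul_eq_zero.1 (?_ : g z * (C z).det = 0)).resolve_left hgz)
  rw [Matrix.det_fin_two]
  linear_combination (C z 0 0) * (c1 z hz) - (C z 0 1) * (c0 z hz)

/-! ### Matrix `q`-difference equations and uniqueness of canonical solutions -/

/-- A `2 × 2` matrix function is bounded on a punctured neighbourhood of `z₀`. -/
def MatrixBoundedNear (F : ℂ → Matrix (Fin 2) (Fin 2) ℂ) (z₀ : ℂ) : Prop :=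
  ∀ i j, BoundedNear (fun z => F z i j) z₀

/-- A `2 × 2` matrix function is meromorphic on the punctured plane. -/
def MatrixMeromorphic (F : ℂ → Matrix (Fin 2) (Fin 2) ℂ) : Prop :=
  ∀ i j, MeromorphicOn (fun z => F z i j) {0}ᶜ

lemma MatrixBoundedNear.mul {F G : ℂ → Matrix (Fin 2) (Fin 2) ℂ} {z₀ : ℂ}
    (hF : MatrixBoundedNear F z₀) (hG : MatrixBoundedNear G z₀) :
    MatrixBoundedNear (fun z => F z * G z) z₀ := fun i j => by
  simpa only [Matrix.mul_apply, Fin.sum_univ_two] using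
    ((hF i 0).mul (hG 0 j)).add ((hF i 1).mul (hG 1 j))

lemma MatrixBoundedNear.smul {c : ℂ → ℂ} {G : ℂ → Matrix (Fin 2) (Fin 2) ℂ} {z₀ : ℂ}
    (hc : BoundedNear c z₀) (hG : MatrixBoundedNear G z₀) :
    MatrixBoundedNear (fun z => c z • G z) z₀ := fun i j => by
  simpa only [Matrix.smul_apply, smul_eq_mul] using hc.mul (hG i j)

lemma MatrixBoundedNear.of_continuous {F : ℂ → Matrix (Fin 2) (Fin 2) ℂ} (hF : Continuous F)
    (z₀ : ℂ) : MatrixBoundedNear F z₀ := fun i j =>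
  BoundedNear.of_continuousAt (hF.matrix_elem i j).continuousAt

lemma MatrixBoundedNear.congr {F G : ℂ → Matrix (Fin 2) (Fin 2) ℂ} {z₀ : ℂ}
    (hF : MatrixBoundedNear F z₀) (h : ∀ᶠ z in 𝓝[≠] z₀, F z = G z) : MatrixBoundedNear G z₀ :=
  fun i j => (hF i j).congr (h.mono fun z hz => by rw [hz])

lemma MatrixMeromorphic.mul {F G : ℂ → Matrix (Fin 2) (Fin 2) ℂ}
    (hF : MatrixMeromorphic F) (hG : MatrixMeromorphic G) :
    MatrixMeromorphic (fun z => F z * G z) := fun i j => by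
  simpa only [Matrix.mul_apply, Fin.sum_univ_two] using
    ((hF i 0).fun_mul (hG 0 j)).fun_add ((hF i 1).fun_mul (hG 1 j))

lemma MatrixMeromorphic.const (M : Matrix (Fin 2) (Fin 2) ℂ) : MatrixMeromorphic fun _ => M :=
  fun i j => MeromorphicOn.const (M i j)

lemma MatrixMeromorphic.comp_neg {F : ℂ → Matrix (Fin 2) (Fin 2) ℂ} (hF : MatrixMeromorphic F) :
    MatrixMeromorphic fun z => F (-z) := fun i j z hz =>
  (hF i j (-z) (by simpa using hz)).comp_analyticAt analyticAt_id.neg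

lemma MatrixMeromorphic.inv {F : ℂ → Matrix (Fin 2) (Fin 2) ℂ} (hF : MatrixMeromorphic F) :
    MatrixMeromorphic (fun z => (F z)⁻¹) := by
  have hdet : MeromorphicOn (fun z => (F z).det) {0}ᶜ := by
    simp only [Matrix.det_fin_two]
    exact ((hF 0 0).fun_mul (hF 1 1)).fun_sub ((hF 0 1).fun_mul (hF 1 0))
  intro i j
  simp only [Matrix.inv_def, Ring.inverse_eq_inv', Matrix.smul_apply, smul_eq_mul,
    Matrix.adjugate_fin_two]
  refine hdet.fun_inv.fun_mul ?_
  fin_cases i <;> fin_cases j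
  · exact hF 1 1
  · exact (hF 0 1).fun_neg
  · exact (hF 1 0).fun_neg
  · exact hF 0 0

lemma inv_mul_gauge {B X Y S T : Matrix (Fin 2) (Fin 2) ℂ} (hB : B.det ≠ 0) :
    (B * X * S)⁻¹ * (B * Y * T) = S⁻¹ * (X⁻¹ * Y) * T := by
  rw [Matrix.mul_inv_rev, Matrix.mul_inv_rev]
  simp only [Matrix.mul_assoc]
  rw [Matrix.nonsing_inv_mul_cancel_left _ _ (isUnit_iff_ne_zero.2 hB)]

lemma inv_diag_fin_two {x y : ℂ} (hx : x ≠ 0) (hy : y ≠ 0) :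
    (!![x, 0; 0, y] : Matrix (Fin 2) (Fin 2) ℂ)⁻¹ = !![x⁻¹, 0; 0, y⁻¹] := by
  refine Matrix.inv_eq_left_inv ?_
  simp [hx, hy, Matrix.one_fin_two]

/-- The inverse of a matrix function with invertible limit is defined and bounded near the limit
point. -/
lemma isBigO_inv_of_asymptotic {l : Filter ℂ} {w : ℂ → ℂ} (hw : Tendsto w l (𝓝 0))
    {Φ : ℂ → Matrix (Fin 2) (Fin 2) ℂ} {M : Matrix (Fin 2) (Fin 2) ℂ} (hM : M.det ≠ 0)
    (h : ∀ i j, (fun z => Φ z i j - M i j) =O[l] w) :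
    (∀ᶠ z in l, (Φ z).det ≠ 0) ∧ ∀ i j, (fun z => (Φ z)⁻¹ i j) =O[l] fun _ => (1 : ℂ) := by
  have hij : ∀ i j, Tendsto (fun z => Φ z i j) l (𝓝 (M i j)) := fun i j => by
    simpa using ((h i j).trans_tendsto hw).add_const (M i j)
  have hlim : Tendsto Φ l (𝓝 M) := tendsto_pi_nhds.2 fun i => tendsto_pi_nhds.2 fun j => hij i j
  have hdet : Tendsto (fun z => (Φ z).det) l (𝓝 M.det) :=
    ((continuous_id.matrix_det).tendsto M).comp hlim
  refine ⟨hdet.eventually_ne hM, fun i j => ?_⟩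
  have hadj : Tendsto (fun z => (Φ z).adjugate i j) l (𝓝 (M.adjugate i j)) :=
    (((continuous_id.matrix_adjugate).matrix_elem i j).tendsto M).comp hlim
  simp only [Matrix.inv_def, Ring.inverse_eq_inv', Matrix.smul_apply, smul_eq_mul]
  exact ((hdet.inv₀ hM).mul hadj).isBigO_one ℂ

/-- Two solutions of `Φ(q z) = B(z) Φ(z) diag(τ₀, τ₁)` with the same invertible limit coincide,
since `Φ⁻¹ Ψ - 1` satisfies scalar equations, with multipliers `τ_j / τ_i`, without small
solutions. The filter `l` and the function `w` specify the limit point and the rate of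
convergence. -/
theorem eventually_eq_of_asymptotic {q : ℂ} {l : Filter ℂ} {w : ℂ → ℂ} (hw : Tendsto w l (𝓝 0))
    {τ : Fin 2 → ℂ} (hτ : ∀ i, τ i ≠ 0)
    (hvan : ∀ (i j : Fin 2) (h : ℂ → ℂ), MeromorphicOn h {0}ᶜ → h =O[l] w →
      (∀ z₀ ≠ 0, ∀ᶠ z in 𝓝[≠] z₀, h (q * z) = (τ i)⁻¹ * τ j * h z) →
      ∀ z₀ ≠ 0, ∀ᶠ z in 𝓝[≠] z₀, h z = 0)
    {B Φ Ψ : ℂ → Matrix (Fin 2) (Fin 2) ℂ} {M : Matrix (Fin 2) (Fin 2) ℂ} (hM : M.det ≠ 0)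
    (hB : ∀ z₀ ≠ 0, ∀ᶠ z in 𝓝[≠] z₀, (B z).det ≠ 0)
    (hΦ : MatrixMeromorphic Φ) (hΨ : MatrixMeromorphic Ψ)
    (hΦq : ∀ z₀ ≠ 0, ∀ᶠ z in 𝓝[≠] z₀, Φ (q * z) = B z * Φ z * !![τ 0, 0; 0, τ 1])
    (hΨq : ∀ z₀ ≠ 0, ∀ᶠ z in 𝓝[≠] z₀, Ψ (q * z) = B z * Ψ z * !![τ 0, 0; 0, τ 1])
    (hΦM : ∀ i j, (fun z => Φ z i j - M i j) =O[l] w)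
    (hΨM : ∀ i j, (fun z => Ψ z i j - M i j) =O[l] w)
    (hΦd : ∀ z₀ ≠ 0, ∀ᶠ z in 𝓝[≠] z₀, (Φ z).det ≠ 0) :
    ∀ z₀ ≠ 0, ∀ᶠ z in 𝓝[≠] z₀, Ψ z = Φ z := by
  set H : ℂ → Matrix (Fin 2) (Fin 2) ℂ := fun z => (Φ z)⁻¹ * Ψ z with hH
  have hHm : MatrixMeromorphic H := hΦ.inv.mul hΨ
  have hHq : ∀ z₀ ≠ 0, ∀ᶠ z in 𝓝[≠] z₀, ∀ i j, H (q * z) i j = (τ i)⁻¹ * τ j * H z i j := by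
    intro z₀ hz₀
    filter_upwards [hΦq z₀ hz₀, hΨq z₀ hz₀, hB z₀ hz₀] with z e1 e2 hBz i j
    have : H (q * z) = !![(τ 0)⁻¹, 0; 0, (τ 1)⁻¹] * H z * !![τ 0, 0; 0, τ 1] := by
      simp only [hH]
      rw [e1, e2, inv_mul_gauge hBz, inv_diag_fin_two (hτ 0) (hτ 1)]
    rw [this]
    simp only [Matrix.mul_apply, Fin.sum_univ_two]
    fin_cases i <;> fin_cases j <;> simp <;> ring
  obtain ⟨hd, hinv⟩ := isBigO_inv_of_asymptotic hw hM hΦM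
  have hHO : ∀ i j, (fun z => H z i j - (1 : Matrix (Fin 2) (Fin 2) ℂ) i j) =O[l] w := by
    intro i j
    have hsub : ∀ i j, (fun z => Ψ z i j - Φ z i j) =O[l] w := fun i j => by
      simpa using (hΨM i j).sub (hΦM i j)
    have h1 : (fun z => (Φ z)⁻¹ i 0 * (Ψ z 0 j - Φ z 0 j) +
        (Φ z)⁻¹ i 1 * (Ψ z 1 j - Φ z 1 j)) =O[l] w := by
      simpa using ((hinv i 0).mul (hsub 0 j)).add ((hinv i 1).mul (hsub 1 j))
    refine h1.congr' ?_ EventuallyEq.rfl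
    filter_upwards [hd] with z hz
    rw [← Matrix.nonsing_inv_mul (Φ z) (isUnit_iff_ne_zero.2 hz)]
    simp only [hH, Matrix.mul_apply, Fin.sum_univ_two]
    ring
  have hzero : ∀ z₀ ≠ 0, ∀ i j, ∀ᶠ z in 𝓝[≠] z₀,
      H z i j - (1 : Matrix (Fin 2) (Fin 2) ℂ) i j = 0 := by
    intro z₀ hz₀ i j
    refine hvan i j _ ((hHm i j).fun_sub (MeromorphicOn.const _)) (hHO i j) ?_ z₀ hz₀
    intro z hz
    filter_upwards [hHq z hz] with v hv
    rw [hv i j]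
    rcases eq_or_ne i j with rfl | hij
    · rw [inv_mul_cancel₀ (hτ i), one_mul, one_mul]
    · rw [Matrix.one_apply_ne hij, sub_zero, sub_zero]
  intro z₀ hz₀
  filter_upwards [eventually_all.2 fun i => eventually_all.2 fun j => hzero z₀ hz₀ i j,
    hΦd z₀ hz₀] with z hz hdz
  have hH1 : (Φ z)⁻¹ * Ψ z = 1 := by
    ext i j
    exact sub_eq_zero.1 (hz i j)
  rw [← Matrix.mul_nonsing_inv_cancel_left (Φ z) (Ψ z) (isUnit_iff_ne_zero.2 hdz), hH1,
    Matrix.mul_one]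

/-! ### The spectral equation of `qP_IV` -/

lemma continuous_laxA (q : ℂ) (a : Fin 3 → ℂ) (t : ℂ) (x : Fin 3 → ℂ) (u : ℂ) :
    Continuous fun z => laxA q a t x u z := by
  have h : ∀ c y : ℂ, Continuous fun z => laxFactor t c y z := by
    intro c y
    refine continuous_matrix fun i j => ?_
    fin_cases i <;> fin_cases j <;> simp [laxFactor] <;> fun_prop
  exact (((continuous_const.matrix_mul (h _ _)).matrix_mul (h _ _)).matrix_mul
    (h _ _)).matrix_mul continuous_const

lemma laxFactor_neg (t c x z : ℂ) :
    laxFactor t c x (-z) = -(!![1, 0; 0, -1] * laxFactor t c x z * !![1, 0; 0, -1]) := by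
  simp [laxFactor]

lemma laxA_neg (q : ℂ) (a : Fin 3 → ℂ) (t : ℂ) (x : Fin 3 → ℂ) (u z : ℂ) :
    laxA q a t x u (-z) = -(!![1, 0; 0, -1] * laxA q a t x u z * !![1, 0; 0, -1]) := by
  have hs : (!![1, 0; 0, -1] : Matrix (Fin 2) (Fin 2) ℂ) * !![1, 0; 0, -1] = 1 := by
    simp [Matrix.one_fin_two]
  have hs' : ∀ X : Matrix (Fin 2) (Fin 2) ℂ,
      (!![1, 0; 0, -1] : Matrix (Fin 2) (Fin 2) ℂ) * (!![1, 0; 0, -1] * X) = X := fun X => by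
    rw [← Matrix.mul_assoc, hs, Matrix.one_mul]
  have hc : ∀ v : ℂ, (!![1, 0; 0, -1] : Matrix (Fin 2) (Fin 2) ℂ) * !![v, 0; 0, 1] =
      !![v, 0; 0, 1] * !![1, 0; 0, -1] := fun v => by simp
  have hc' : ∀ (v : ℂ) (X : Matrix (Fin 2) (Fin 2) ℂ),
      (!![1, 0; 0, -1] : Matrix (Fin 2) (Fin 2) ℂ) * (!![v, 0; 0, 1] * X) =
      !![v, 0; 0, 1] * (!![1, 0; 0, -1] * X) := fun v X => by
    rw [← Matrix.mul_assoc, hc, Matrix.mul_assoc]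
  simp only [laxA, laxFactor_neg, Matrix.mul_assoc, Matrix.neg_mul, Matrix.mul_neg, neg_neg, hs',
    hc', hc]

lemma det_laxFactor {t x : ℂ} (ht : t ≠ 0) (hx : x ≠ 0) (c z : ℂ) :
    (laxFactor t c x z).det = (1 - c * z) * (1 + c * z) := by
  simp only [laxFactor, Matrix.det_fin_two_of]
  field_simp
  linear_combination (c ^ 2 * z ^ 2) * Complex.I_sq

lemma eventually_one_sub_mul_ne_zero (c z₀ : ℂ) : ∀ᶠ z in 𝓝[≠] z₀, 1 - c * z ≠ 0 := by
  rcases eq_or_ne (1 - c * z₀) 0 with h | h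
  · filter_upwards [self_mem_nhdsWithin] with z hz h'
    have hc : c ≠ 0 := by rintro rfl; simp at h
    exact hz (mul_left_cancel₀ hc (by linear_combination h - h'))
  · have : ContinuousAt (fun z => 1 - c * z) z₀ := by fun_prop
    exact (this.eventually_ne h).filter_mono nhdsWithin_le_nhds

lemma eventually_det_laxA_ne_zero (q : ℂ) (a : Fin 3 → ℂ) {t : ℂ} (ht : t ≠ 0) {x : Fin 3 → ℂ}
    (hx : ∀ k, x k ≠ 0) {u : ℂ} (hu : u ≠ 0) (z₀ : ℂ) :
    ∀ᶠ z in 𝓝[≠] z₀, (laxA q a t x u z).det ≠ 0 := by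
  have h : ∀ c y : ℂ, y ≠ 0 → ∀ᶠ z in 𝓝[≠] z₀, (laxFactor t c y z).det ≠ 0 := by
    intro c y hy
    filter_upwards [eventually_one_sub_mul_ne_zero c z₀,
      eventually_one_sub_mul_ne_zero (-c) z₀] with z h1 h2
    rw [det_laxFactor ht hy]
    exact mul_ne_zero h1 (by simpa using h2)
  filter_upwards [h q _ (hx 2), h (a 0 * a 2) _ (hx 0), h (a 0) _ (hx 1)] with z h1 h2 h3
  simp only [laxA, Matrix.det_mul, Matrix.det_fin_two_of]
  simp [h1, h2, h3, hu]

lemma det_matM0_ne_zero {u d : ℂ} (hu : u ≠ 0) (hd : d ≠ 0) : (matM0 u d).det ≠ 0 := by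
  simp only [matM0, Matrix.det_smul, Matrix.det_mul, Matrix.det_fin_two_of]
  simp [hu, hd]

/-- Reflection `z ↦ -z` of the canonical solution at `0`. -/
lemma IsCanonicalAtZero.reflect {q : ℂ} {A : ℂ → Matrix (Fin 2) (Fin 2) ℂ}
    (hA : ∀ z, A (-z) = -(!![1, 0; 0, -1] * A z * !![1, 0; 0, -1])) {u d : ℂ}
    {Φ : ℂ → Matrix (Fin 2) (Fin 2) ℂ} (h : IsCanonicalAtZero q A (matM0 u d) Φ) :
    IsCanonicalAtZero q A (matM0 u d)
      fun z => !![1, 0; 0, -1] * Φ (-z) * -!![0, 1; 1, 0] where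
  meromorphic := ((MatrixMeromorphic.const _).mul (MatrixMeromorphic.comp_neg h.meromorphic)).mul
    (MatrixMeromorphic.const _)
  equation := fun z₀ hz₀ => by
    filter_upwards [(tendsto_neg_nhdsNE z₀).eventually (h.equation _ (neg_ne_zero.2 hz₀))] with z hz
    rw [mul_neg] at hz
    rw [hz, hA]
    ext i j
    simp only [Matrix.neg_apply, Matrix.mul_apply, Fin.sum_univ_two]
    fin_cases i <;> fin_cases j <;> simp [-mul_eq_mul_left_iff] <;> ring
  asymptotic := fun i j => by
    have ht : Tendsto (fun z : ℂ => -z) (𝓝[≠] 0) (𝓝[≠] 0) := by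
      simpa using tendsto_neg_nhdsNE 0
    have h' : ∀ i j, (fun z => Φ (-z) i j - matM0 u d i j) =O[𝓝[≠] (0 : ℂ)] fun z => z :=
      fun i j => ((h.asymptotic i j).comp_tendsto ht).neg_right.congr_right fun z => by simp
    fin_cases i <;> fin_cases j
    · refine (h' 0 1).neg_left.congr_left fun z => ?_
      simp only [matM0, Matrix.smul_apply, Matrix.neg_apply, Matrix.mul_apply, Fin.sum_univ_two]
      simp
      ring
    · refine (h' 0 0).neg_left.congr_left fun z => ?_
      simp only [matM0, Matrix.smul_apply, Matrix.neg_apply, Matrix.mul_apply, Fin.sum_univ_two]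
      simp
      ring
    · refine (h' 1 1).congr_left fun z => ?_
      simp only [matM0, Matrix.smul_apply, Matrix.neg_apply, Matrix.mul_apply, Fin.sum_univ_two]
      simp
    · refine (h' 1 0).congr_left fun z => ?_
      simp only [matM0, Matrix.smul_apply, Matrix.neg_apply, Matrix.mul_apply, Fin.sum_univ_two]
      simp

/-- Reflection `z ↦ -z` of the canonical solution at `∞`. -/
lemma IsCanonicalAtInfinity.reflect {q : ℂ} {a : Fin 3 → ℂ} {t : ℂ}
    {A : ℂ → Matrix (Fin 2) (Fin 2) ℂ}
    (hA : ∀ z, A (-z) = -(!![1, 0; 0, -1] * A z * !![1, 0; 0, -1]))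
    {Φ : ℂ → Matrix (Fin 2) (Fin 2) ℂ} (h : IsCanonicalAtInfinity q a t A Φ) :
    IsCanonicalAtInfinity q a t A fun z => !![1, 0; 0, -1] * Φ (-z) * !![1, 0; 0, -1] where
  meromorphic := ((MatrixMeromorphic.const _).mul (MatrixMeromorphic.comp_neg h.meromorphic)).mul
    (MatrixMeromorphic.const _)
  equation := fun z₀ hz₀ => by
    filter_upwards [(tendsto_neg_nhdsNE z₀).eventually (h.equation _ (neg_ne_zero.2 hz₀))] with z hz
    rw [mul_neg] at hz
    rw [hz, hA]
    have hz3 : ((-z) ^ 3)⁻¹ = -(z ^ 3)⁻¹ := by rw [← inv_neg]; ring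
    rw [hz3]
    ext i j
    simp only [Matrix.smul_apply, smul_eq_mul, Matrix.neg_apply, Matrix.mul_apply, Fin.sum_univ_two]
    fin_cases i <;> fin_cases j <;> simp [-mul_eq_mul_left_iff] <;> ring
  asymptotic := fun i j => by
    have ht : Tendsto (fun z : ℂ => -z) (Bornology.cobounded ℂ) (Bornology.cobounded ℂ) :=
      tendsto_neg_cobounded
    have h' : ∀ i j, (fun z => Φ (-z) i j - (1 : Matrix (Fin 2) (Fin 2) ℂ) i j)
        =O[Bornology.cobounded ℂ] fun z => z⁻¹ :=
      fun i j => ((h.asymptotic i j).comp_tendsto ht).neg_right.congr_right fun z => by simp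
    fin_cases i <;> fin_cases j
    · refine (h' 0 0).congr_left fun z => ?_
      simp only [Matrix.mul_apply, Fin.sum_univ_two]
      simp
    · refine (h' 0 1).neg_left.congr_left fun z => ?_
      simp only [Matrix.mul_apply, Fin.sum_univ_two]
      simp
    · refine (h' 1 0).neg_left.congr_left fun z => ?_
      simp only [Matrix.mul_apply, Fin.sum_univ_two]
      simp
    · refine (h' 1 1).congr_left fun z => ?_
      simp only [Matrix.mul_apply, Fin.sum_univ_two]
      simp

/-! ### Properties of the connection matrix -/

section Connection

variable {q : ℂ} {a : Fin 3 → ℂ} {t : ℂ} {A Φ₀ Φinf : ℂ → Matrix (Fin 2) (Fin 2) ℂ} {u d : ℂ}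

lemma IsCanonicalAtZero.eventually_det_ne_zero (hq : q ≠ 0) (hq1 : ‖q‖ < 1)
    (hu : u ≠ 0) (hd : d ≠ 0) (h : IsCanonicalAtZero q A (matM0 u d) Φ₀) :
    ∀ z₀ ≠ 0, ∀ᶠ z in 𝓝[≠] z₀, (Φ₀ z).det ≠ 0 := by
  refine forall_of_near_zero hq hq1 (exists_forall_eventually_of_eventually_zero
    (isBigO_inv_of_asymptotic (tendsto_id.mono_left nhdsWithin_le_nhds)
      (det_matM0_ne_zero hu hd) h.asymptotic).1) fun z₀ hz₀ hz => ?_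
  filter_upwards [(tendsto_const_mul_nhdsNE hq z₀).eventually hz, h.equation z₀ hz₀] with z h1 h2
  rw [h2, Matrix.det_mul, Matrix.det_mul] at h1
  exact right_ne_zero_of_mul (left_ne_zero_of_mul h1)

/-- The inverse of the canonical solution at `0` has no poles on the punctured plane. -/
lemma IsCanonicalAtZero.inv_boundedNear (hq : q ≠ 0) (hq1 : ‖q‖ < 1) (hAc : Continuous A)
    (hAd : ∀ z₀ ≠ 0, ∀ᶠ z in 𝓝[≠] z₀, (A z).det ≠ 0) (hu : u ≠ 0) (hd : d ≠ 0)
    (h : IsCanonicalAtZero q A (matM0 u d) Φ₀) :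
    ∀ z₀ ≠ 0, MatrixBoundedNear (fun z => (Φ₀ z)⁻¹) z₀ := by
  have hO := (isBigO_inv_of_asymptotic (tendsto_id.mono_left nhdsWithin_le_nhds)
    (det_matM0_ne_zero hu hd) h.asymptotic).2
  choose C hC using fun i j => (hO i j).bound
  have hev := exists_forall_eventually_of_eventually_zero
    (eventually_all.2 fun i => eventually_all.2 fun j => hC i j)
  refine forall_of_near_zero hq hq1 (hev.imp fun r hr => ⟨hr.1, fun z hz hzr i j =>
    IsBigO.of_bound (C i j) ((hr.2 z hz hzr).mono fun w hw => hw i j)⟩) fun z₀ hz₀ hb => ?_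
  have hb' : MatrixBoundedNear (fun z => (Φ₀ (q * z))⁻¹) z₀ :=
    fun i j => (hb i j).comp_const_mul hq
  refine (((MatrixBoundedNear.of_continuous continuous_const z₀).mul hb').mul
    (MatrixBoundedNear.of_continuous hAc z₀)).congr
    (F := fun z => !![-Complex.I, 0; 0, Complex.I] * (Φ₀ (q * z))⁻¹ * A z) ?_
  filter_upwards [h.equation z₀ hz₀, hAd z₀ hz₀] with z e hdet
  have hD : IsUnit (!![-Complex.I, 0; 0, Complex.I] : Matrix (Fin 2) (Fin 2) ℂ).det := by
    simp
  rw [e, Matrix.mul_inv_rev, Matrix.mul_nonsing_inv_cancel_left _ _ hD, Matrix.mul_inv_rev,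
    Matrix.nonsing_inv_mul_cancel_right _ _ (isUnit_iff_ne_zero.2 hdet)]

/-- The factor `(q a₀² a₂ i z³)⁻¹` of the spectral equation at `∞`. -/
def infinityFactor (q : ℂ) (a : Fin 3 → ℂ) (z : ℂ) : ℂ :=
  (q * a 0 ^ 2 * a 2 * Complex.I)⁻¹ * (z ^ 3)⁻¹

lemma IsParameter.infinityFactor_ne_zero (hqa : IsParameter q a) {z : ℂ} (hz : z ≠ 0) :
    infinityFactor q a z ≠ 0 := by
  have hq := hqa.q_ne_zero
  have h0 := hqa.a_ne_zero 0
  have h2 := hqa.a_ne_zero 2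
  simp [infinityFactor, hq, h0, h2, hz]

lemma IsCanonicalAtInfinity.eventually_det_ne_zero (hqa : IsParameter q a) (ht : t ≠ 0)
    (hAd : ∀ z₀ ≠ 0, ∀ᶠ z in 𝓝[≠] z₀, (A z).det ≠ 0)
    (h : IsCanonicalAtInfinity q a t A Φinf) :
    ∀ z₀ ≠ 0, ∀ᶠ z in 𝓝[≠] z₀, (Φinf z).det ≠ 0 := by
  refine forall_of_near_infinity hqa.q_ne_zero hqa.norm_q_lt_one
    (exists_forall_eventually_of_eventually_cobounded
    (isBigO_inv_of_asymptotic tendsto_inv₀_cobounded (M := 1) (by simp) h.asymptotic).1)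
    fun z₀ hz₀ hz => eventually_nhdsNE_mul hqa.q_ne_zero ?_
  filter_upwards [hz, h.equation z₀ hz₀, hAd z₀ hz₀, eventually_ne_zero_nhdsNE hz₀]
    with z h1 h2 h3 h4
  have hc := hqa.infinityFactor_ne_zero h4
  rw [infinityFactor] at hc
  rw [h2, Matrix.det_smul, Matrix.det_mul, Matrix.det_mul, Matrix.det_fin_two_of]
  simp only [Fintype.card_fin, mul_zero, sub_zero, inv_mul_cancel₀ ht, mul_one]
  exact mul_ne_zero (pow_ne_zero _ hc) (mul_ne_zero h3 h1)

/-- The canonical solution at `∞` has no poles on the punctured plane. -/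
lemma IsCanonicalAtInfinity.boundedNear (hqa : IsParameter q a) (hAc : Continuous A)
    (h : IsCanonicalAtInfinity q a t A Φinf) : ∀ z₀ ≠ 0, MatrixBoundedNear Φinf z₀ := by
  have hO : ∀ i j, (fun z => Φinf z i j) =O[Bornology.cobounded ℂ] fun _ => (1 : ℂ) := fun i j => by
    have h1 := (h.asymptotic i j).trans
      ((tendsto_inv₀_cobounded (α := ℂ)).isBigO_one (F := ℂ))
    simpa using h1.add (isBigO_const_const ((1 : Matrix (Fin 2) (Fin 2) ℂ) i j)
      (one_ne_zero (α := ℂ)) (Bornology.cobounded ℂ))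
  choose C hC using fun i j => (hO i j).bound
  have hev := exists_forall_eventually_of_eventually_cobounded
    (eventually_all.2 fun i => eventually_all.2 fun j => hC i j)
  refine forall_of_near_infinity hqa.q_ne_zero hqa.norm_q_lt_one
    (hev.imp fun R hR z hz hzr i j => IsBigO.of_bound (C i j)
      ((hR z hz hzr).mono fun w hw => hw i j)) fun z₀ hz₀ hb i j => ?_
  refine BoundedNear.of_comp_const_mul hqa.q_ne_zero ?_
  have hc : BoundedNear (infinityFactor q a) z₀ := BoundedNear.of_continuousAt
    (continuousAt_const.mul ((continuousAt_id.pow 3).inv₀ (pow_ne_zero 3 hz₀)))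
  refine (MatrixBoundedNear.smul hc (((MatrixBoundedNear.of_continuous hAc z₀).mul hb).mul
    (MatrixBoundedNear.of_continuous (continuous_const (y := !![t⁻¹, 0; 0, t])) z₀))).congr
    (G := fun z => Φinf (q * z)) ?_ i j
  filter_upwards [h.equation z₀ hz₀] with z hz
  exact hz.symm

lemma IsCanonicalAtZero.eventually_eq (hq : q ≠ 0) (hq1 : ‖q‖ < 1)
    (hAd : ∀ z₀ ≠ 0, ∀ᶠ z in 𝓝[≠] z₀, (A z).det ≠ 0) (hu : u ≠ 0) (hd : d ≠ 0)
    {Ψ : ℂ → Matrix (Fin 2) (Fin 2) ℂ} (h : IsCanonicalAtZero q A (matM0 u d) Φ₀)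
    (h' : IsCanonicalAtZero q A (matM0 u d) Ψ) : ∀ z₀ ≠ 0, ∀ᶠ z in 𝓝[≠] z₀, Ψ z = Φ₀ z := by
  have hpow : ∀ n : ℕ, n ≠ 0 → ‖q ^ n‖ < 1 := fun n hn => by
    rw [norm_pow]
    exact pow_lt_one₀ (norm_nonneg q) hq1 hn
  refine eventually_eq_of_asymptotic (τ := ![-Complex.I, Complex.I]) (w := fun z => z)
    (tendsto_id.mono_left nhdsWithin_le_nhds) ?_ ?_ (det_matM0_ne_zero hu hd) hAd h.meromorphic
    h'.meromorphic h.equation h'.equation h.asymptotic h'.asymptotic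
    (h.eventually_det_ne_zero hq hq1 hu hd)
  · intro i
    fin_cases i <;> simp
  · -- The multipliers `τ_j / τ_i = ±1` have modulus one.
    intro i j f hf hO hfq
    have hnorm : ‖(![-Complex.I, Complex.I] i)⁻¹ * ![-Complex.I, Complex.I] j‖ = 1 := by
      fin_cases i <;> fin_cases j <;> simp
    refine eventually_eq_zero_of_qDifference hq hq1 (norm_ne_zero_iff.1 (by rw [hnorm]; simp)) ?_
      hf hO hfq
    intro n hn e
    exact (hpow n hn).ne (by rw [← e, hnorm])

lemma IsCanonicalAtInfinity.eventually_eq (hqa : IsParameter q a) (ht : t ≠ 0)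
    (ht2 : ∀ n : ℤ, t ^ 2 ≠ q ^ n)
    (hAd : ∀ z₀ ≠ 0, ∀ᶠ z in 𝓝[≠] z₀, (A z).det ≠ 0)
    {Ψ : ℂ → Matrix (Fin 2) (Fin 2) ℂ} (h : IsCanonicalAtInfinity q a t A Φinf)
    (h' : IsCanonicalAtInfinity q a t A Ψ) : ∀ z₀ ≠ 0, ∀ᶠ z in 𝓝[≠] z₀, Ψ z = Φinf z := by
  have hq := hqa.q_ne_zero
  have hq1 := hqa.norm_q_lt_one
  have hpow : ∀ n : ℕ, n ≠ 0 → (1 : ℂ) ≠ q ^ n := fun n hn e => by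
    have : ‖q‖ ^ n < 1 := pow_lt_one₀ (norm_nonneg q) hq1 hn
    rw [← norm_pow, ← e, norm_one] at this
    exact lt_irrefl _ this
  refine eventually_eq_of_asymptotic (q := q) (τ := ![t⁻¹, t]) (w := fun z => z⁻¹) (M := 1)
    (l := Bornology.cobounded ℂ) (B := fun z => infinityFactor q a z • A z)
    tendsto_inv₀_cobounded ?_ ?_ (by simp) ?_ h.meromorphic
    h'.meromorphic ?_ ?_ h.asymptotic h'.asymptotic (h.eventually_det_ne_zero hqa ht hAd)
  · intro i
    fin_cases i <;> simp [ht]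
  · -- The multipliers `τ_j / τ_i` are `1` and `t^{±2}`.
    intro i j f hf hO hfq
    refine eventually_eq_zero_of_qDifference_infinity hq hq1 ?_ ?_ hf hO hfq
    · fin_cases i <;> fin_cases j <;> simp [ht]
    · intro n hn e
      fin_cases i <;> fin_cases j
      · exact hpow n hn (by simpa [ht] using e)
      · refine ht2 (-n) ?_
        have e' : (t * t)⁻¹ = q ^ n := by simpa using e
        rw [zpow_neg, zpow_natCast, ← e', inv_inv, sq]
      · refine ht2 n ?_
        have e' : t * t = q ^ n := by simpa using e
        rw [zpow_natCast, ← e', sq]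
      · exact hpow n hn (by simpa [ht] using e)
  · intro z₀ hz₀
    filter_upwards [hAd z₀ hz₀, eventually_ne_zero_nhdsNE hz₀] with z h1 h2
    rw [Matrix.det_smul]
    exact mul_ne_zero (pow_ne_zero _ (hqa.infinityFactor_ne_zero h2)) h1
  · intro z₀ hz₀
    filter_upwards [h.equation z₀ hz₀] with z hz
    rw [hz, Matrix.smul_mul, Matrix.smul_mul]
    rfl
  · intro z₀ hz₀
    filter_upwards [h'.equation z₀ hz₀] with z hz
    rw [hz, Matrix.smul_mul, Matrix.smul_mul]
    rfl

/-- The analytic properties of a connection matrix at time `t` from which the theorem follows. -/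
structure IsConnectionLike (q : ℂ) (a : Fin 3 → ℂ) (t : ℂ) (C : ℂ → Matrix (Fin 2) (Fin 2) ℂ) :
    Prop where
  analyticAt : ∀ z ≠ 0, ∀ i j, AnalyticAt ℂ (fun z => C z i j) z
  qDifference : ∀ z ≠ 0, C (q * z) =
    (multiplier q a * (z ^ 3)⁻¹) • (!![1, 0; 0, -1] * C z * !![t⁻¹, 0; 0, t])
  reflection : ∀ z ≠ 0, C (-z) = -(!![0, 1; 1, 0] * C z * !![1, 0; 0, -1])
  det_ne_zero : ∀ z₀ ≠ 0, ∀ᶠ z in 𝓝[≠] z₀, (C z).det ≠ 0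

/-- The connection matrix of two canonical solutions is holomorphic on the punctured plane and
inherits its `q`-difference equation and its reflection symmetry from the canonical solutions. -/
theorem isConnectionLike_connectionMatrix (hqa : IsParameter q a) (ht : t ≠ 0)
    (ht2 : ∀ n : ℤ, t ^ 2 ≠ q ^ n) (hAc : Continuous A)
    (hAd : ∀ z₀ ≠ 0, ∀ᶠ z in 𝓝[≠] z₀, (A z).det ≠ 0)
    (hAn : ∀ z, A (-z) = -(!![1, 0; 0, -1] * A z * !![1, 0; 0, -1])) (hu : u ≠ 0) (hd : d ≠ 0)
    (h0 : IsCanonicalAtZero q A (matM0 u d) Φ₀) (h : IsCanonicalAtInfinity q a t A Φinf) :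
    IsConnectionLike q a t (connectionMatrix Φ₀ Φinf) := by
  have hq := hqa.q_ne_zero
  have hq1 := hqa.norm_q_lt_one
  set G : ℂ → Matrix (Fin 2) (Fin 2) ℂ := fun z => (Φ₀ z)⁻¹ * Φinf z with hG
  set C := connectionMatrix Φ₀ Φinf with hC
  have hGm : MatrixMeromorphic G := (MatrixMeromorphic.inv h0.meromorphic).mul h.meromorphic
  have hGb : ∀ z ≠ 0, MatrixBoundedNear G z := fun z hz =>
    (h0.inv_boundedNear hq hq1 hAc hAd hu hd z hz).mul (h.boundedNear hqa hAc z hz)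
  have hCa : ∀ z ≠ 0, ∀ i j, AnalyticAt ℂ (fun z => C z i j) z := fun z hz i j =>
    analyticAt_toMeromorphicNFOn_of_boundedNear (hGm i j) (by simpa using hz) (hGb z hz i j)
  have hCc : ∀ z ≠ 0, ContinuousAt C z := fun z hz =>
    continuousAt_pi.2 fun i => continuousAt_pi.2 fun j => (hCa z hz i j).continuousAt
  have hCG : ∀ z₀ ≠ 0, ∀ᶠ z in 𝓝[≠] z₀, C z = G z := by
    intro z₀ hz₀
    have : ∀ i j, ∀ᶠ z in 𝓝[≠] z₀, C z i j = G z i j := fun i j =>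
      (hGm i j).toMeromorphicNFOn_eq_self_on_nhdsNE (by simpa using hz₀)
    filter_upwards [eventually_all.2 fun i => eventually_all.2 fun j => this i j] with z hz
    ext i j
    exact hz i j
  refine ⟨hCa, fun z hz => ?_, fun z hz => ?_, fun z₀ hz₀ => ?_⟩
  · refine eq_of_eventually_eq_nhdsNE (h := fun z => C (q * z)) (k := fun z =>
      (multiplier q a * (z ^ 3)⁻¹) • (!![1, 0; 0, -1] * C z * !![t⁻¹, 0; 0, t])) ?_ ?_ ?_
    · exact ContinuousAt.comp (f := fun z => q * z) (hCc _ (mul_ne_zero hq hz)) (by fun_prop)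
    · have hmul : Continuous fun M : Matrix (Fin 2) (Fin 2) ℂ =>
          !![1, 0; 0, -1] * M * !![t⁻¹, 0; 0, t] :=
        (continuous_const.matrix_mul continuous_id).matrix_mul continuous_const
      exact (continuousAt_const.mul ((continuousAt_id.pow 3).inv₀ (pow_ne_zero 3 hz))).smul
        (hmul.continuousAt.comp (hCc z hz))
    · filter_upwards [hCG z hz, (tendsto_const_mul_nhdsNE hq z).eventually
        (hCG _ (mul_ne_zero hq hz)), h0.equation z hz, h.equation z hz, hAd z hz]
        with w e1 e2 e3 e4 hdet
      rw [e1, e2]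
      simp only [hG]
      rw [e3, e4, Matrix.mul_smul, inv_mul_gauge hdet,
        inv_diag_fin_two (neg_ne_zero.2 Complex.I_ne_zero) Complex.I_ne_zero]
      have hD : (!![(-Complex.I)⁻¹, 0; 0, Complex.I⁻¹] : Matrix (Fin 2) (Fin 2) ℂ) =
          Complex.I • !![1, 0; 0, -1] := by simp [inv_neg]
      rw [hD, Matrix.smul_mul, Matrix.smul_mul, smul_smul]
      congr 1
      rw [multiplier, mul_inv _ Complex.I, mul_right_comm, inv_mul_cancel_right₀ Complex.I_ne_zero]
  · refine eq_of_eventually_eq_nhdsNE (h := fun z => C (-z)) (k := fun z =>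
      -(!![0, 1; 1, 0] * C z * !![1, 0; 0, -1])) ?_ ?_ ?_
    · exact ContinuousAt.comp (f := fun z : ℂ => -z) (hCc _ (neg_ne_zero.2 hz)) (by fun_prop)
    · have hmul : Continuous fun M : Matrix (Fin 2) (Fin 2) ℂ =>
          -(!![0, 1; 1, 0] * M * !![1, 0; 0, -1]) :=
        ((continuous_const.matrix_mul continuous_id).matrix_mul continuous_const).neg
      exact hmul.continuousAt.comp (hCc z hz)
    · filter_upwards [hCG z hz, (tendsto_neg_nhdsNE z).eventually (hCG _ (neg_ne_zero.2 hz)),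
        h0.eventually_eq hq hq1 hAd hu hd (h0.reflect hAn) z hz,
        h.eventually_eq hqa ht ht2 hAd (h.reflect hAn) z hz] with w e1 e2 e3 e4
      rw [e1, e2]
      simp only [hG]
      rw [← e3, ← e4, inv_mul_gauge (by simp)]
      have hS : (-!![0, 1; 1, 0] : Matrix (Fin 2) (Fin 2) ℂ)⁻¹ = -!![0, 1; 1, 0] :=
        Matrix.inv_eq_left_inv (by simp [Matrix.one_fin_two])
      rw [hS]
      ext i j
      simp only [Matrix.neg_apply, Matrix.mul_apply, Fin.sum_univ_two]
      fin_cases i <;> fin_cases j <;> simp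
  · filter_upwards [hCG z₀ hz₀, h0.eventually_det_ne_zero hq hq1 hu hd z₀ hz₀,
      h.eventually_det_ne_zero hqa ht hAd z₀ hz₀] with z e d1 d2
    rw [e]
    simp only [hG]
    rw [Matrix.det_mul, Matrix.det_nonsing_inv, Ring.inverse_eq_inv']
    exact mul_ne_zero (inv_ne_zero d1) d2

/-- The time evolution `C(z, q t) = σ₃ C(z, t) z^{-σ₃}` preserves the properties of a connection
matrix. -/
lemma IsConnectionLike.timeEvolution (hq : q ≠ 0) {t₀ : ℂ} (ht₀ : t₀ ≠ 0) {n : ℤ}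
    {C : ℂ → Matrix (Fin 2) (Fin 2) ℂ} (h : IsConnectionLike q a (q ^ n * t₀) C) :
    IsConnectionLike q a t₀
      fun z => !![1, 0; 0, (-1) ^ n] * C z * !![z ^ n, 0; 0, z ^ (-n)] where
  analyticAt := fun z hz i j => by
    simp only [Matrix.mul_apply, Fin.sum_univ_two]
    have hz1 : AnalyticAt ℂ (fun z : ℂ => z ^ n) z := analyticAt_id.zpow hz
    have hz2 : AnalyticAt ℂ (fun z : ℂ => z ^ (-n)) z := analyticAt_id.zpow hz
    have hentry : ∀ i j, AnalyticAt ℂ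
        (fun z => (!![z ^ n, 0; 0, z ^ (-n)] : Matrix (Fin 2) (Fin 2) ℂ) i j) z := by
      intro i j
      fin_cases i <;> fin_cases j
      · exact hz1
      · exact analyticAt_const
      · exact analyticAt_const
      · exact hz2
    have hrow : ∀ j, AnalyticAt ℂ (fun z =>
        (!![1, 0; 0, (-1) ^ n] : Matrix (Fin 2) (Fin 2) ℂ) i 0 * C z 0 j +
        (!![1, 0; 0, (-1) ^ n] : Matrix (Fin 2) (Fin 2) ℂ) i 1 * C z 1 j) z := fun j =>
      (analyticAt_const.mul (h.analyticAt z hz 0 j)).add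
        (analyticAt_const.mul (h.analyticAt z hz 1 j))
    exact ((hrow 0).mul (hentry 0 j)).add ((hrow 1).mul (hentry 1 j))
  qDifference := fun z hz => by
    have hqn : q ^ n ≠ 0 := zpow_ne_zero n hq
    have hzn : z ^ n ≠ 0 := zpow_ne_zero n hz
    rw [h.qDifference z hz]
    ext i j
    simp only [Matrix.smul_apply, smul_eq_mul, Matrix.mul_apply, Fin.sum_univ_two]
    fin_cases i <;> fin_cases j <;> simp [mul_zpow, -mul_eq_mul_left_iff] <;> field_simp
  reflection := fun z hz => by
    have hone : ((-1 : ℂ) ^ n) * (-1) ^ n = 1 := by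
      rw [← mul_zpow]; simp
    have hinv : ((-1 : ℂ) ^ n)⁻¹ = (-1) ^ n := by rw [← inv_zpow]; norm_num
    have hz' : (-z) ^ n = (-1) ^ n * z ^ n := by rw [← mul_zpow]; simp
    rw [h.reflection z hz]
    ext i j
    simp only [Matrix.neg_apply, Matrix.mul_apply, Fin.sum_univ_two]
    fin_cases i <;> fin_cases j <;> simp [hz', hinv, -mul_eq_mul_left_iff, -mul_eq_mul_right_iff]
    · ring
    · ring
    · linear_combination (C z 0 0 * z ^ n) * hone
    · linear_combination (C z 0 1 * (z ^ n)⁻¹) * hone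
  det_ne_zero := fun z₀ hz₀ => by
    filter_upwards [h.det_ne_zero z₀ hz₀, eventually_ne_zero_nhdsNE hz₀] with z hdet hz
    rw [Matrix.det_mul, Matrix.det_mul, Matrix.det_fin_two_of, Matrix.det_fin_two_of]
    simp [hdet, zpow_ne_zero n hz, zpow_ne_zero n (neg_ne_zero.2 (one_ne_zero (α := ℂ)))]

end Connection

lemma affine_ne_zero {p : CP1} (hp : InCStar p) : affine p ≠ 0 := div_ne_zero hp.1 hp.2

lemma IsConnectionMatrix.isConnectionLike {q : ℂ} {a : Fin 3 → ℂ} (hqa : IsParameter q a)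
    {f : ℂ → Fin 3 → CP1} {t₀ : ℂ} (ht₀ : t₀ ≠ 0) (ht2 : ∀ n : ℤ, t₀ ^ 2 ≠ q ^ n)
    {C : ℂ → Matrix (Fin 2) (Fin 2) ℂ} (h : IsConnectionMatrix q a f t₀ C) :
    IsConnectionLike q a t₀ C := by
  obtain ⟨n, u, d, Φ₀, Φinf, hf, hu, hd, h0, hinf, hC⟩ := h
  have hq := hqa.q_ne_zero
  have ht : q ^ n * t₀ ≠ 0 := mul_ne_zero (zpow_ne_zero n hq) ht₀
  have ht2' : ∀ m : ℤ, (q ^ n * t₀) ^ 2 ≠ q ^ m := by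
    intro m e
    refine ht2 (m - 2 * n) ?_
    rw [zpow_sub₀ hq, ← e, mul_comm 2 n, zpow_mul, mul_pow]
    have : q ^ n ≠ 0 := zpow_ne_zero n hq
    norm_cast
    field_simp
  rw [show C = _ from funext hC]
  exact (isConnectionLike_connectionMatrix hqa ht ht2' (continuous_laxA _ _ _ _ _)
    (fun z _ => eventually_det_laxA_ne_zero q a ht (fun k => affine_ne_zero (hf k)) hu z)
    (laxA_neg _ _ _ _ _) hu hd h0 hinf).timeEvolution hq ht₀

end QPIV

end
theorem mainTheorem4 (q : ℂ) (a : Fin 3 → ℂ) (hqa : QPIV.IsParameter q a)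
    (hres : QPIV.NonResonant q a) :
    (∀ (T : Set ℂ) (f : ℂ → Fin 3 → QPIV.CP1), QPIV.IsSolution q a T f →
      ∀ t₀ ∈ T, (∀ n : ℤ, t₀ ^ 2 ≠ q ^ n) →
      (∃ n : ℤ, QPIV.IsNonsingular (f (q ^ n * t₀))) →
      ∀ p : Fin 3 → QPIV.CP1, QPIV.IsMonodromyCoordinates q a f t₀ p →
        ¬ QPIV.OnForbiddenCurve q a p) ∧
    (∀ p : Fin 3 → QPIV.CP1, QPIV.OnForbiddenCurve q a p →
      ∀ t : ℂ, t ≠ 0 → QPIV.OnMonodromyCubic q a t p) := by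
  refine ⟨?_, ?_⟩
  · rintro T f hf t₀ htT ht2 - p ⟨C, hC, hp⟩
    have ht₀ : t₀ ≠ 0 := fun h => hf.zero_notMem (h ▸ htT)
    have h := hC.isConnectionLike hqa ht₀ ht2
    refine QPIV.not_onForbiddenCurve_of_matrix hqa hres ht₀ (fun n e => ht2 (n * 2) ?_)
      h.analyticAt h.qDifference h.reflection h.det_ne_zero fun k => (hp k).2
    rw [e, zpow_mul]
    norm_cast
  · -- The cubic is `θ(t)` times the first equation of the curve minus `θ(-t)` times the second.
    rintro p ⟨h1, h2⟩ t -
    unfold QPIV.OnMonodromyCubic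
    linear_combination (QPIV.theta q t) * h1 - (QPIV.theta q (-t)) * h2
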